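/- **Setting.** Let $\mathcal S,\mathcal A$ be finite sets, $H\ge 1$, $\mu_0$ a probability distribution on $\mathcal S$, and $p=(p_h)_{h=1}^H$ a transition model, $p_h(\cdot\mid s,a)$ being a distribution on $\mathcal S$. Let $\pi^E$ be a deterministic policy (the expert) and $\pi^b$ a possibly stochastic policy (the behavioral policy). For a policy $\pi$ let $\rho^{p,\pi}_h(s,a)$ be the probability that $(s_h,a_h)=(s,a)$ when $s_1\sim\mu_0$ and $\pi$ is played, $\rho^{p,\pi}_h(s)=\sum_a\rho^{p,\pi}_h(s,a)$, $\mathcal S^{p,\pi}=\{(s,h):\rho^{p,\pi}_h(s)>0\}$, $\mathcal Z^{p,\pi}=\{(s,a,h):\rho^{p,\pi}_h(s,a)>0\}$, $S^{p,\pi}_{\max}=\max_h|\{s:(s,h)\in\mathcal S^{p,\pi}\}|$ and $\rho_{\min}^{\pi}=\min_{(s,a,h)\in\mathcal Z^{p,\pi}}\rho^{p,\pi}_h(s,a)$. Assume $\pi^b_h(\pi^E_h(s)\mid s)>0$ for all $(s,h)\in\mathcal S^{p,\pi^E}$. A reward is a function $r=(r_h)_{h=1}^H$ with $r_h:\mathcal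 S\times\mathcal A\to\mathbb R$. Let $Q^\pi_h(s,a;p,r)$ be the expected value of $\sum_{t=h}^H r_t(s_t,a_t)$ when starting from $(s,a)$ at stage $h$ and playing $\pi$ afterwards, and let $J(\pi;p,r)$ be the expected return of $\pi$ from $s_1\sim\mu_0$. The feasible set is $\mathcal R_{p,\pi^E}=\{r: J(\pi^E;p,r)=\max_\pi J(\pi;p,r)\}$. The sub- and super-feasible sets $\mathcal R^\cap$ and $\mathcal R^\cup$ are the intersection and the union of $\mathcal R_{p',\pi^E}$ over all transition models $p'$ that agree with $p$ on $\mathcal Z^{p,\pi^b}$. Put $$d_\infty(r,r')=\frac{\sum_{h=1}^H\|r_h-r'_h\|_\infty}{\max\{\|r\|_\infty,\|r'\|_\infty\}}\qquad(0\text{ if the denominator vanishes}),$$ and let $\mathcal H_\infty(\mathcal R,\mathcal R')=\max\{\sup_{r\in\mathcal R}\inf_{r'\in\mathcal R'}d_\infty(r,r'),\ \sup_{r'\in\mathcal R'}\inf_{r\in\mathcal R}d_\infty(r,r')\}$. **Algorithm IRLO.** From $\tau^E$ expert and $\tau^b$ behavioral trajectories $(s_1,a_1,\dots,s_H,a_H)$,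 all independent, IRLO computes: the set $\widehat{\mathcal S}$ of the pairs $(s,h)$ visited in the expert data; for each $(s,h)\in\widehat{\mathcal S}$ an action $\widehat\pi_h(s)$ played in $s$ at stage $h$ in some expert trajectory; the set $\widehat{\mathcal Z}$ of the triples $(s,a,h)$ visited in the behavioral data; and, for $(s,a,h)\in\widehat{\mathcal Z}$ with $h<H$, the empirical transition frequencies $\widehat p_h(\cdot\mid s,a)$ in the behavioral data. It returns the intersection $\widehat{\mathcal R}^\cap$ and the union $\widehat{\mathcal R}^\cup$, over all transition models $p'$ that agree with $\widehat p$ at all $(s,a,h)\in\widehat{\mathcal Z}$ with $h<H$, of the sets of rewards $r$ such that $Q^{\bar\pi}_h(s,\widehat\pi_h(s);p',r)\ge Q^{\bar\pi}_h(s,a;p',r)$ for all policies $\bar\pi$ that agree with $\widehat\pi$ on $\widehat{\mathcal S}$, all $(s,h)\in\widehat{\mathcal S}$ and all $a\in\mathcal A$. **Theorem.** For $\delta\in(0,1)$ put $\ell_\delta=\max\{1,\ln\frac1\delta\}$. There are universal constants $C>0$ and $k\in\mathbb N$ such that, in every setting as above, for all $\epsilon\in(0,2H]$, all $\delta\in(0,1)$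 and all integers $\tau^E\ge1$, $\tau^b\ge 0$ with $$\tau^b\ge C\,F\,\ln^k(2+F),\qquad F=\frac{H^4\,\ell_\delta}{\rho_{\min}^{\pi^b}\,\epsilon^2}\Bigl(\ell_\delta+S^{p,\pi^b}_{\max}\Bigr)+\frac{\ell_\delta}{\ln\frac{1}{1-\rho_{\min}^{\pi^b}}},$$ $$\tau^E\ge C\,\frac{\ell_\delta}{\ln\frac1{1-\rho_{\min}^{\pi^E}}}\,\ln^k\bigl(2+|\mathcal S^{p,\pi^E}|\bigr)$$ (a fraction with denominator $\ln\frac1{1-\rho}$ is $0$ when $\rho=1$), IRLO is $(\epsilon,\delta)$-PAC for $d_\infty$-IRL: with probability at least $1-\delta$, whichever admissible choice of $\widehat\pi$ is made, $$\mathcal H_\infty(\mathcal R^\cap,\widehat{\mathcal R}^\cap)\le\epsilon\quad\text{and}\quad\mathcal H_\infty(\mathcal R^\cup,\widehat{\mathcal R}^\cup)\le\epsilon .$$ -/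

import Mathlib

open scoped ENNReal BigOperators

noncomputable section

namespace OfflineIRL

/-! Finite-horizon Markov decision processes without reward.  `S` is the state space, `A` the
action space, `H ≥ 1` the horizon.  Stage `h ∈ {1, …, H}` is the element `h - 1` of `Fin H`. -/

/-- Transition models: `p h s a` is the distribution of the next state when `a` is played in `s`
at stage `h`. -/
abbrev Trans (S A : Type*) [Fintype S] (H : ℕ) := Fin H → S → A → stdSimplex ℝ S

/-- (Stochastic) policies: `π h s` is a distribution over actions. -/
abbrev Policy (S A : Type*) [Fintype A] (H : ℕ) := Fin H → S → stdSimplex ℝ A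

/-- Deterministic policies. -/
abbrev DetPolicy (S A : Type*) (H : ℕ) := Fin H → S → A

/-- Real-valued rewards, not assumed bounded by any fixed constant. -/
abbrev Reward (S A : Type*) (H : ℕ) := Fin H → S × A → ℝ

/-- Trajectories `(s₁, a₁, …, s_H, a_H)`. -/
abbrev Traj (S A : Type*) (H : ℕ) := Fin H → S × A

section Basic

variable {S A : Type*} [Fintype S] [Fintype A] {H : ℕ}

open Classical in
/-- A deterministic policy seen as a stochastic one. -/
def DetPolicy.toPolicy (π : DetPolicy S A H) : Policy S A H :=
  fun h s => stdSimplex.vertex (π h s)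

/-- Probability of the trajectory `ω` when `π` is played:
`μ₀(s₁) π₁(a₁|s₁) p₁(s₂|s₁,a₁) π₂(a₂|s₂) ⋯ π_H(a_H|s_H)`. -/
def trajProb (μ₀ : stdSimplex ℝ S) (p : Trans S A H) (π : Policy S A H) (ω : Traj S A H) : ℝ :=
  ∏ h : Fin H,
    (if h.1 = 0 then μ₀ (ω h).1
      else
        let g : Fin H := ⟨h.1 - 1, by omega⟩
        p g (ω g).1 (ω g).2 (ω h).1) * π h (ω h).1 (ω h).2

open Classical in
/-- State-action visitation distribution: the probability that `s_h = s` and `a_h = a`. -/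
def visit (μ₀ : stdSimplex ℝ S) (p : Trans S A H) (π : Policy S A H) (h : Fin H) (s : S) (a : A) :
    ℝ :=
  ∑ ω : Traj S A H, if ω h = (s, a) then trajProb μ₀ p π ω else 0

/-- State visitation distribution. -/
def visitState (μ₀ : stdSimplex ℝ S) (p : Trans S A H) (π : Policy S A H) (h : Fin H) (s : S) :
    ℝ :=
  ∑ a, visit μ₀ p π h s a

/-- The pairs `(s, h)` reached with positive probability. -/
def stateSupport (μ₀ : stdSimplex ℝ S) (p : Trans S A H) (π : Policy S A H) : Set (S × Fin H) :=
  {x | 0 < visitState μ₀ p π x.2 x.1}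

/-- The triples `(s, a, h)` reached with positive probability. -/
def saSupport (μ₀ : stdSimplex ℝ S) (p : Trans S A H) (π : Policy S A H) :
    Set (S × A × Fin H) :=
  {x | 0 < visit μ₀ p π x.2.2 x.1 x.2.1}

/-- `S_max`: the largest number of states reachable at one stage. -/
def maxStateSupport (μ₀ : stdSimplex ℝ S) (p : Trans S A H) (π : Policy S A H) : ℕ :=
  Finset.univ.sup fun h : Fin H => {s : S | (s, h) ∈ stateSupport μ₀ p π}.ncard

/-- `ρ_min`: the smallest value of the visitation distribution on its support (a minimum over a
finite set, which is non-empty as soon as `H ≥ 1`). -/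
def rhoMin (μ₀ : stdSimplex ℝ S) (p : Trans S A H) (π : Policy S A H) : ℝ :=
  sInf ((fun x : S × A × Fin H => visit μ₀ p π x.2.2 x.1 x.2.1) '' saSupport μ₀ p π)

/-- The `Q`-function of `π` under `p` and `r`, i.e. the expected sum of the rewards collected from
stage `h` on when starting from `(s, a)` at stage `h` and playing `π` afterwards. -/
def Q (p : Trans S A H) (r : Reward S A H) (π : Policy S A H) (h : Fin H) (s : S) (a : A) : ℝ :=
  r h (s, a) +
    if hn : h.1 + 1 < H then
      ∑ s', p h s a s' * ∑ a', π ⟨h.1 + 1, hn⟩ s' a' * Q p r π ⟨h.1 + 1, hn⟩ s' a'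
    else 0
termination_by H - h.1
decreasing_by omega

/-- Expected return `J(π; μ₀, p, r)`. -/
def J [NeZero H] (μ₀ : stdSimplex ℝ S) (p : Trans S A H) (r : Reward S A H) (π : Policy S A H) :
    ℝ :=
  ∑ s, μ₀ s * ∑ a, π 0 s a * Q p r π 0 s a

/-- The feasible set: rewards for which `πE` attains the maximum of the expected return over all
policies. -/
def feasible [NeZero H] (μ₀ : stdSimplex ℝ S) (p : Trans S A H) (πE : DetPolicy S A H) :
    Set (Reward S A H) :=
  {r | IsGreatest (Set.range (J μ₀ p r)) (J μ₀ p r πE.toPolicy)}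

/-- Transition models that agree with `p` on `Z`. -/
def transClass (p : Trans S A H) (Z : Set (S × A × Fin H)) : Set (Trans S A H) :=
  {p' | ∀ s a h, (s, a, h) ∈ Z → p' h s a = p h s a}

/-- Policies that agree with `π` on `X`. -/
def policyClass (π : Policy S A H) (X : Set (S × Fin H)) : Set (Policy S A H) :=
  {π' | ∀ s h, (s, h) ∈ X → π' h s = π h s}

/-- Sub-feasible set. -/
def subFeasible [NeZero H] (μ₀ : stdSimplex ℝ S) (p : Trans S A H) (πE : DetPolicy S A H)
    (πb : Policy S A H) : Set (Reward S A H) :=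
  ⋂ p' ∈ transClass p (saSupport μ₀ p πb), feasible μ₀ p' πE

/-- Super-feasible set. -/
def superFeasible [NeZero H] (μ₀ : stdSimplex ℝ S) (p : Trans S A H) (πE : DetPolicy S A H)
    (πb : Policy S A H) : Set (Reward S A H) :=
  ⋃ p' ∈ transClass p (saSupport μ₀ p πb), feasible μ₀ p' πE

/-! Dissimilarities.  `‖·‖` is the supremum norm here, since rewards are functions on finite
types. -/

/-- `d_∞(r, r') = (∑_h ‖r_h - r'_h‖_∞) / max (‖r‖_∞, ‖r'‖_∞)`, and `0` if the denominator is
`0`. -/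
def dInf (r r' : Reward S A H) : ℝ :=
  (∑ h, ‖r h - r' h‖) / max ‖r‖ ‖r'‖

/-- Hausdorff distance between two sets of rewards with inner distance `d_∞`. -/
def hausdorffInf (R R' : Set (Reward S A H)) : ℝ≥0∞ :=
  max (⨆ r ∈ R, ⨅ r' ∈ R', ENNReal.ofReal (dInf r r'))
    (⨆ r' ∈ R', ⨅ r ∈ R, ENNReal.ofReal (dInf r r'))

/-- The expert's covering assumption: on the support of `πE`, the behavioral policy plays the
expert's action with positive probability. -/
def Covers (μ₀ : stdSimplex ℝ S) (p : Trans S A H) (πE : DetPolicy S A H) (πb : Policy S A H) :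
    Prop :=
  ∀ s h, (s, h) ∈ stateSupport μ₀ p πE.toPolicy → 0 < πb h s (πE h s)

end Basic

/-! The algorithm IRLO, run on an expert dataset `DE` and a behavioral dataset `Db`. -/

section Algorithm

variable {S A : Type*} [Fintype S] [Fintype A] {H τ τE τb : ℕ}

/-- Empirical support of the expert. -/
def estStateSupport (DE : Fin τ → Traj S A H) : Set (S × Fin H) :=
  {x | ∃ i, (DE i x.2).1 = x.1}

/-- `π̂` is a possible value of the empirical expert's policy: in every visited `(s, h)` it plays
the action of some trajectory that visits `s` at stage `h`. -/
def IsEstPolicy (DE : Fin τ → Traj S A H) (πhat : DetPolicy S A H) : Prop :=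
  ∀ s h, (s, h) ∈ estStateSupport DE → ∃ i, DE i h = (s, πhat h s)

/-- Empirical state-action support of the behavioral policy. -/
def estSaSupport (Db : Fin τ → Traj S A H) : Set (S × A × Fin H) :=
  {x | ∃ i, Db i x.2.2 = (x.1, x.2.1)}

open Classical in
/-- Number of trajectories with `(s_h, a_h, s_{h+1}) = (s, a, s')`, for `h` not the last stage. -/
def count (Db : Fin τ → Traj S A H) (h : Fin H) (hn : h.1 + 1 < H) (s : S) (a : A) (s' : S) : ℕ :=
  (Finset.univ.filter fun i => Db i h = (s, a) ∧ (Db i ⟨h.1 + 1, hn⟩).1 = s').card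

/-- Empirical transition probabilities. -/
def estTrans (Db : Fin τ → Traj S A H) (h : Fin H) (hn : h.1 + 1 < H) (s : S) (a : A) (s' : S) :
    ℝ :=
  (count Db h hn s a s' : ℝ) / max 1 (∑ s'', (count Db h hn s a s'' : ℝ))

/-- Transition models that agree with the empirical one on the empirical support.  The datasets
end with `(s_H, a_H)`, so that no transition out of the last stage is observed; such transitions
influence no value function and are left free. -/
def estTransClass (Db : Fin τ → Traj S A H) : Set (Trans S A H) :=
  {p' | ∀ s a h, (s, a, h) ∈ estSaSupport Db → ∀ hn : h.1 + 1 < H,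
    ∀ s', p' h s a s' = estTrans Db h hn s a s'}

/-- Rewards for which, under `p`, every policy that agrees with `π` on `X` satisfies the optimality
inequalities of the actions of `π` at all points of `X`. -/
def feasibleOn (p : Trans S A H) (π : DetPolicy S A H) (X : Set (S × Fin H)) :
    Set (Reward S A H) :=
  {r | ∀ π' ∈ policyClass π.toPolicy X, ∀ s h, (s, h) ∈ X →
    ∀ a, Q p r π' h s a ≤ Q p r π' h s (π h s)}

/-- The estimated sub-feasible set returned by IRLO when `πhat` is the empirical expert's
policy. -/
def irloSub (DE : Fin τE → Traj S A H) (Db : Fin τb → Traj S A H) (πhat : DetPolicy S A H) :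
    Set (Reward S A H) :=
  ⋂ p' ∈ estTransClass Db, feasibleOn p' πhat (estStateSupport DE)

/-- The estimated super-feasible set returned by IRLO when `πhat` is the empirical expert's
policy. -/
def irloSuper (DE : Fin τE → Traj S A H) (Db : Fin τb → Traj S A H) (πhat : DetPolicy S A H) :
    Set (Reward S A H) :=
  ⋃ p' ∈ estTransClass Db, feasibleOn p' πhat (estStateSupport DE)

open Classical in
/-- Probability of the event `E` when `DE` consists of `τE` independent trajectories of `πE`, `Db`
of `τb` independent trajectories of `πb`, and the two datasets are independent. -/
def dataProb (μ₀ : stdSimplex ℝ S) (p : Trans S A H) (πE : DetPolicy S A H) (πb : Policy S A H)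
    (E : Set ((Fin τE → Traj S A H) × (Fin τb → Traj S A H))) : ℝ :=
  ∑ D : (Fin τE → Traj S A H) × (Fin τb → Traj S A H),
    if D ∈ E then
      (∏ i, trajProb μ₀ p πE.toPolicy (D.1 i)) * ∏ i, trajProb μ₀ p πb (D.2 i)
    else 0

/-- IRLO is `(ε, δ)`-PAC for `d_∞`-IRL on the given instance with `τE` expert and `τb` behavioral
trajectories, for every way of choosing the empirical expert's policy. -/
def IRLOIsPAC [NeZero H] (μ₀ : stdSimplex ℝ S) (p : Trans S A H) (πE : DetPolicy S A H)
    (πb : Policy S A H) (τE τb : ℕ) (ε δ : ℝ) : Prop :=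
  1 - δ ≤ dataProb (τE := τE) (τb := τb) μ₀ p πE πb
    {D | ∀ πhat, IsEstPolicy D.1 πhat →
      hausdorffInf (subFeasible μ₀ p πE πb) (irloSub D.1 D.2 πhat) ≤ ENNReal.ofReal ε ∧
      hausdorffInf (superFeasible μ₀ p πE πb) (irloSuper D.1 D.2 πhat) ≤ ENNReal.ofReal ε}

end Algorithm

/-! The two rates. -/

/-- `ln (1/δ)`, read as `1` when `δ > 1/e`. -/
def logInv (δ : ℝ) : ℝ := max 1 (Real.log (1 / δ))

/-- `H⁴ ln(1/δ) (ln(1/δ) + S_max) / (ρ_min ε²) + ln(1/δ) / ln(1/(1-ρ_min))`. The second summand is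
`0` for `ρ_min = 1`. -/
def rateB (H Smax : ℕ) (ρ ε δ : ℝ) : ℝ :=
  (H : ℝ) ^ 4 * logInv δ / (ρ * ε ^ 2) * (logInv δ + Smax) +
    logInv δ / Real.log (1 / (1 - ρ))

/-- `ln(1/δ) / ln(1/(1-ρ_min))`, which is `0` for `ρ_min = 1`. -/
def rateE (ρ δ : ℝ) : ℝ :=
  logInv δ / Real.log (1 / (1 - ρ))

end OfflineIRL

end

open OfflineIRL

set_option linter.unusedSectionVars false

namespace OfflineIRL

/-! ### Bellman characterisations of feasibility. -/

section Values

variable {S A : Type*} [Fintype S] [Fintype A] {H : ℕ}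

/-! The argument separates a deterministic comparison of reward sets from a probabilistic estimate
of the data.

Deterministic part. Let `X` be the expert's reachable set and `Z` the behavioral support. A reward
is feasible for a model exactly when the optimal value function `V` satisfies the expert's Bellman
equation on `X` (`feasible_eq_feasibleOn`), and the set that IRLO uses has the same description. So
membership is a system of Bellman relations on `V`, and it survives a change of model from `p` to
`q` on `Z` if the reward is corrected by `(p - q) V` there (`shiftReward`). Since `|V| ≤ H ‖r‖`, an
`L¹` error `t` costs at most `t H ‖r‖` per stage, hence `H² t` in `d_∞`; dividing by the norm is
what allows unbounded rewards. For the union, `V` is the optimal value of one witnessing model. For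
the intersection, `V` is the robust value, in which the next state is chosen freely outside `Z`: one
function is then a supersolution for all completions at once. See `exists_near_union`,
`exists_near_inter` and `hausdorffInf_irlo_le`.

Probabilistic part. It suffices that the data recover `X` and `Z` exactly and estimate `p` on `Z` up
to `ε / H²` in `L¹`. A missed expert state has geometric probability. For the model, a Chernoff
bound controls the number of visits, and a Bernstein-type bound controls the empirical mean of each
sign function on the reachable next states; the union over at most `2 ^ S_max` sign functions gives
the `L¹` norm. Each stage carries total mass one, so `|Z| ≤ H / ρ_min`, which the rate dominates up
to a constant. The remaining union bound thus costs only a logarithm of the rate, and neither `|S|`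
nor `|A|` enters. -/

lemma sum_mul_le_of_le {T : Type*} [Fintype T] (q : stdSimplex ℝ T) {f : T → ℝ} {c : ℝ}
    (hf : ∀ x, f x ≤ c) : ∑ x, q x * f x ≤ c := by
  calc ∑ x, q x * f x ≤ ∑ x, q x * c :=
        Finset.sum_le_sum fun x _ => mul_le_mul_of_nonneg_left (hf x) (stdSimplex.zero_le q x)
    _ = c := by rw [← Finset.sum_mul, stdSimplex.sum_eq_one, one_mul]

lemma abs_sum_mul_le {T : Type*} [Fintype T] (q : stdSimplex ℝ T) {f : T → ℝ} {c : ℝ}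
    (hf : ∀ x, |f x| ≤ c) : |∑ x, q x * f x| ≤ c := by
  rw [abs_le]
  constructor
  · have := sum_mul_le_of_le q (f := fun x => - f x) (c := c)
      fun x => (neg_le_abs _).trans (hf x)
    simp only [mul_neg, Finset.sum_neg_distrib] at this
    linarith
  · exact sum_mul_le_of_le q fun x => (le_abs_self _).trans (hf x)

lemma sum_vertex_mul {T : Type*} [Fintype T] [DecidableEq T] (x : T) (f : T → ℝ) :
    ∑ y, (stdSimplex.vertex x : stdSimplex ℝ T) y * f y = f x := by
  rw [Finset.sum_eq_single x]
  · simp [DFunLike.coe]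
  · intro y _ hy
    simp [DFunLike.coe, hy]
  · simp

lemma sum_toPolicy_mul (π : DetPolicy S A H) (h : Fin H) (s : S) (f : A → ℝ) :
    ∑ a, π.toPolicy h s a * f a = f (π h s) := by
  classical
  unfold DetPolicy.toPolicy
  convert! sum_vertex_mul (π h s) f

lemma backward_induction {P : Fin H → Prop}
    (step : ∀ h, (∀ hn : h.1 + 1 < H, P ⟨h.1 + 1, hn⟩) → P h) (h : Fin H) : P h := by
  obtain ⟨h, hh⟩ := h
  induction hk : H - h using Nat.strong_induction_on generalizing h with
  | _ k ih =>
    subst hk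
    exact step _ fun hn => ih (H - (h + 1)) (by omega) (h + 1) hn rfl

/-- Expected value of `V` at the next stage. -/
def next (p : Trans S A H) (V : ℕ → S → ℝ) (h : Fin H) (s : S) (a : A) : ℝ :=
  ∑ s', p h s a s' * V (h.1 + 1) s'

lemma next_of_last (p : Trans S A H) {V : ℕ → S → ℝ} (hV : ∀ s, V H s = 0) {h : Fin H}
    (hn : ¬ h.1 + 1 < H) (s : S) (a : A) : next p V h s a = 0 := by
  have : h.1 + 1 = H := by omega
  simp [next, this, hV]

/-- `V` bounds the Bellman backups from above. -/
structure IsSuperSol (p : Trans S A H) (r : Reward S A H) (V : ℕ → S → ℝ) : Prop where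
  last : ∀ s, V H s = 0
  le : ∀ h s a, r h (s, a) + next p V h s a ≤ V h.1 s

/-- `X` is closed under the transitions of `π`. -/
def IsClosedUnder (p : Trans S A H) (π : DetPolicy S A H) (X : Set (S × Fin H)) : Prop :=
  ∀ s h, (s, h) ∈ X → ∀ hn : h.1 + 1 < H, ∀ s', 0 < p h s (π h s) s' →
    (s', (⟨h.1 + 1, hn⟩ : Fin H)) ∈ X

/-- The Bellman equation of `π` holds for `V` on `X`. -/
def BellmanOn (p : Trans S A H) (r : Reward S A H) (π : DetPolicy S A H) (X : Set (S × Fin H))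
    (V : ℕ → S → ℝ) : Prop :=
  ∀ s h, (s, h) ∈ X → V h.1 s = r h (s, π h s) + next p V h s (π h s)

lemma IsSuperSol.Q_le {p : Trans S A H} {r : Reward S A H} {V : ℕ → S → ℝ}
    (hV : IsSuperSol p r V) (π : Policy S A H) (h : Fin H) :
    ∀ s a, Q p r π h s a ≤ r h (s, a) + next p V h s a := by
  refine backward_induction (P := fun h => ∀ s a, Q p r π h s a ≤ r h (s, a) + next p V h s a)
    ?_ h
  intro h ih s a
  rw [Q]
  gcongr
  split_ifs with hn
  · refine Finset.sum_le_sum fun s' _ => mul_le_mul_of_nonneg_left ?_ (stdSimplex.zero_le _ _)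
    exact sum_mul_le_of_le _ fun a' => (ih hn s' a').trans (hV.le _ _ _)
  · rw [next_of_last p hV.last hn]

/-- Once in `X`, the expert's actions never leave it, so the value is the same for every
continuation that agrees with `π` on `X`. -/
lemma Q_eq_of_bellmanOn {p : Trans S A H} {r : Reward S A H} {V : ℕ → S → ℝ}
    {π : DetPolicy S A H} {X : Set (S × Fin H)} (hlast : ∀ s, V H s = 0)
    (hB : BellmanOn p r π X V) (hX : IsClosedUnder p π X) {π' : Policy S A H}
    (hπ' : π' ∈ policyClass π.toPolicy X) (h : Fin H) :
    ∀ s, (s, h) ∈ X → Q p r π' h s (π h s) = V h.1 s := by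
  refine backward_induction
    (P := fun h => ∀ s, (s, h) ∈ X → Q p r π' h s (π h s) = V h.1 s) ?_ h
  intro h ih s hs
  rw [Q, hB s h hs]
  congr 1
  split_ifs with hn
  · refine Finset.sum_congr rfl fun s' _ => ?_
    rcases (stdSimplex.zero_le (p h s (π h s)) s').eq_or_lt with h0 | h0
    · rw [← h0, zero_mul, zero_mul]
    · have hs' := hX s h hs hn s' h0
      rw [hπ' s' _ hs', sum_toPolicy_mul, ih hn s' hs']
  · rw [next_of_last p hlast hn]

/-- A supersolution bounds every `Q`-value, and its tightness on `X` makes it the value of the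
expert's action. -/
lemma mem_feasibleOn_of_isSuperSol {p : Trans S A H} {r : Reward S A H} {V : ℕ → S → ℝ}
    {π : DetPolicy S A H} {X : Set (S × Fin H)} (hV : IsSuperSol p r V)
    (hB : BellmanOn p r π X V) (hX : IsClosedUnder p π X) : r ∈ feasibleOn p π X := by
  intro π' hπ' s h hs a
  rw [Q_eq_of_bellmanOn hV.last hB hX hπ' h s hs]
  exact (hV.Q_le π' h s a).trans (hV.le h s a)

/-- `V` solves the Bellman optimality equations. -/
structure IsOptimal (p : Trans S A H) (r : Reward S A H) (V : ℕ → S → ℝ) : Prop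
    extends IsSuperSol p r V where
  attained : ∀ (h : Fin H) s, ∃ a, V h.1 s = r h (s, a) + next p V h s a

/-- The test policy follows `π` on `X` and is greedy for `V` elsewhere. By backward induction its
`Q`-function is the Bellman backup of `V`, and the inequality against the greedy action then forces
equality on `X`. -/
lemma IsOptimal.bellmanOn {p : Trans S A H} {r : Reward S A H} {V : ℕ → S → ℝ}
    {π : DetPolicy S A H} {X : Set (S × Fin H)} (hV : IsOptimal p r V)
    (hr : r ∈ feasibleOn p π X) : BellmanOn p r π X V := by
  classical
  choose g hg using hV.attained
  set π' : DetPolicy S A H := fun h s => if (s, h) ∈ X then π h s else g h s with hπ'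
  have hmem : π'.toPolicy ∈ policyClass π.toPolicy X := by
    intro s h hs
    simp [DetPolicy.toPolicy, hπ', hs]
  have key : ∀ h : Fin H, (∀ s a, Q p r π'.toPolicy h s a = r h (s, a) + next p V h s a) ∧
      ∀ s, V h.1 s = r h (s, π' h s) + next p V h s (π' h s) := by
    refine backward_induction fun h ih => ?_
    have h1 : ∀ s a, Q p r π'.toPolicy h s a = r h (s, a) + next p V h s a := by
      intro s a
      rw [Q]
      congr 1
      split_ifs with hn
      · refine Finset.sum_congr rfl fun s' _ => ?_
        obtain ⟨i1, i2⟩ := ih hn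
        rw [sum_toPolicy_mul, i1, ← i2]
      · rw [next_of_last p hV.last hn]
    refine ⟨h1, fun s => ?_⟩
    by_cases hs : (s, h) ∈ X
    · have := hr _ hmem s h hs (g h s)
      rw [h1, h1, ← hg] at this
      simp only [hπ', hs, if_true]
      exact le_antisymm this (hV.le h s _)
    · simp only [hπ', hs, if_false]
      exact hg h s
  intro s h hs
  have := (key h).2 s
  simpa only [hπ', hs, if_true] using this

/-- `X` is the set of pairs reached with positive probability, described by recursion. -/
structure IsReach [NeZero H] (μ₀ : stdSimplex ℝ S) (p : Trans S A H) (π : DetPolicy S A H)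
    (X : Set (S × Fin H)) : Prop where
  init : ∀ s, (s, (0 : Fin H)) ∈ X ↔ 0 < μ₀ s
  closed : IsClosedUnder p π X
  pred : ∀ h : Fin H, ∀ hn : h.1 + 1 < H, ∀ s', (s', (⟨h.1 + 1, hn⟩ : Fin H)) ∈ X →
    ∃ s, (s, h) ∈ X ∧ 0 < p h s (π h s) s'

lemma J_toPolicy [NeZero H] (μ₀ : stdSimplex ℝ S) (p : Trans S A H) (r : Reward S A H)
    (π : DetPolicy S A H) :
    J μ₀ p r π.toPolicy = ∑ s, μ₀ s * Q p r π.toPolicy 0 s (π 0 s) := by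
  simp only [J, sum_toPolicy_mul]

lemma IsSuperSol.J_le [NeZero H] {μ₀ : stdSimplex ℝ S} {p : Trans S A H} {r : Reward S A H}
    {V : ℕ → S → ℝ} (hV : IsSuperSol p r V) (π : Policy S A H) :
    J μ₀ p r π ≤ ∑ s, μ₀ s * V 0 s := by
  refine Finset.sum_le_sum fun s _ => mul_le_mul_of_nonneg_left ?_ (stdSimplex.zero_le _ _)
  exact sum_mul_le_of_le _ fun a => (hV.Q_le π 0 s a).trans (hV.le 0 s a)

lemma mem_feasible_of_isSuperSol [NeZero H] {μ₀ : stdSimplex ℝ S} {p : Trans S A H}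
    {r : Reward S A H} {V : ℕ → S → ℝ} {π : DetPolicy S A H} {X : Set (S × Fin H)}
    (hV : IsSuperSol p r V) (hB : BellmanOn p r π X V) (hX : IsReach μ₀ p π X) :
    r ∈ feasible μ₀ p π := by
  refine ⟨⟨_, rfl⟩, ?_⟩
  rintro _ ⟨π', rfl⟩
  refine (hV.J_le π').trans (le_of_eq ?_)
  rw [J_toPolicy]
  refine Finset.sum_congr rfl fun s _ => ?_
  rcases (stdSimplex.zero_le μ₀ s).eq_or_lt with h0 | h0
  · rw [← h0, zero_mul, zero_mul]
  · rw [Q_eq_of_bellmanOn hV.last hB hX.closed (fun _ _ _ => rfl) 0 s ((hX.init s).2 h0)]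
    rfl

/-- Equality of averages of pointwise ordered functions forces equality wherever the weight is
positive. This carries optimality from a state to its successors. -/
lemma eq_of_sum_mul_le {T : Type*} [Fintype T] (q : stdSimplex ℝ T) {f g : T → ℝ}
    (hfg : ∀ x, f x ≤ g x) (h : ∑ x, q x * g x ≤ ∑ x, q x * f x) {x : T} (hx : 0 < q x) :
    f x = g x := by
  have hle : ∀ x ∈ Finset.univ, q x * f x ≤ q x * g x := fun x _ =>
    mul_le_mul_of_nonneg_left (hfg x) (stdSimplex.zero_le _ _)
  have := (Finset.sum_eq_sum_iff_of_le hle).1 (le_antisymm (Finset.sum_le_sum hle) h) x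
    (Finset.mem_univ x)
  exact mul_left_cancel₀ hx.ne' this

/-- Optimality of the return is an averaged statement. It gives equality with `V` at the initial
states, and equality at a state passes to its successors, so going forward in time it reaches all of
`X`. -/
lemma IsOptimal.bellmanOn_of_feasible [NeZero H] {μ₀ : stdSimplex ℝ S} {p : Trans S A H}
    {r : Reward S A H} {V : ℕ → S → ℝ} {π : DetPolicy S A H} {X : Set (S × Fin H)}
    (hV : IsOptimal p r V) (hX : IsReach μ₀ p π X) (hr : r ∈ feasible μ₀ p π) :
    BellmanOn p r π X V := by
  choose g hg using hV.attained
  have hle : ∀ (h : Fin H) s, Q p r π.toPolicy h s (π h s) ≤ V h.1 s := fun h s =>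
    (hV.Q_le _ h s _).trans (hV.le h s _)
  have key : ∀ n (hn : n < H) s, (s, (⟨n, hn⟩ : Fin H)) ∈ X →
      Q p r π.toPolicy ⟨n, hn⟩ s (π ⟨n, hn⟩ s) = V n s := by
    intro n
    induction n with
    | zero =>
      intro hn s hs
      have h0 : (⟨0, hn⟩ : Fin H) = 0 := rfl
      rw [h0] at hs ⊢
      refine eq_of_sum_mul_le μ₀ (f := fun s => Q p r π.toPolicy 0 s (π 0 s)) (g := V 0)
        (fun s => hle 0 s) ?_ ((hX.init s).1 hs)
      -- The greedy policy `g` attains the average of `V` at the first stage, so the expert's return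
      -- is at least that average.
      have h1 := hr.2 ⟨DetPolicy.toPolicy g, rfl⟩
      rw [J_toPolicy, J_toPolicy] at h1
      refine le_trans (le_of_eq ?_) h1
      refine Finset.sum_congr rfl fun s _ => ?_
      rw [Q_eq_of_bellmanOn (X := Set.univ) (π := g) hV.last (fun s h _ => hg h s)
        (fun _ _ _ _ _ _ => trivial) (fun _ _ _ => rfl) 0 s trivial]
      rfl
    | succ n ih =>
      intro hn s' hs'
      obtain ⟨s, hs, hp⟩ := hX.pred ⟨n, by omega⟩ hn s' hs'
      have h1 := ih (by omega) s hs
      have h2 := hV.le ⟨n, by omega⟩ s (π ⟨n, by omega⟩ s)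
      rw [Q, dif_pos hn] at h1
      simp only [sum_toPolicy_mul] at h1
      rw [← h1] at h2
      exact eq_of_sum_mul_le (p ⟨n, by omega⟩ s (π ⟨n, by omega⟩ s))
        (f := fun s' => Q p r π.toPolicy ⟨n + 1, hn⟩ s' (π ⟨n + 1, hn⟩ s')) (g := V (n + 1))
        (fun s => hle _ s) (by simpa [next] using h2) hp
  intro s h hs
  refine le_antisymm ?_ (hV.le h s _)
  rw [← key h.1 h.2 s hs]
  exact hV.Q_le _ h s _

end Values

/-! ### Optimal values when the model is unknown outside `Z`. -/

section Robust

variable {S A : Type*} [Fintype S] [Fintype A] {H : ℕ}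

open Classical in
/-- Optimal value when, outside `Z`, the next state may be chosen freely. -/
noncomputable def robustValue (p : Trans S A H) (Z : Set (S × A × Fin H)) (r : Reward S A H)
    (h : ℕ) (s : S) : ℝ :=
  if hh : h < H then
    ⨆ a, (r ⟨h, hh⟩ (s, a) +
      if (s, a, (⟨h, hh⟩ : Fin H)) ∈ Z then
        ∑ s', p ⟨h, hh⟩ s a s' * robustValue p Z r (h + 1) s'
      else ⨆ s', robustValue p Z r (h + 1) s')
  else 0
termination_by H - h
decreasing_by all_goals omega

variable [Nonempty S] [Nonempty A]

open Classical in
/-- The transition model that attains the robust value. -/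
noncomputable def worstTrans (p : Trans S A H) (Z : Set (S × A × Fin H)) (r : Reward S A H) :
    Trans S A H :=
  fun h s a => if (s, a, h) ∈ Z then p h s a else
    stdSimplex.vertex
      (exists_eq_ciSup_of_finite (f := fun s' => robustValue p Z r (h.1 + 1) s')).choose

lemma worstTrans_of_mem (p : Trans S A H) {Z : Set (S × A × Fin H)} (r : Reward S A H)
    {h : Fin H} {s : S} {a : A} (hz : (s, a, h) ∈ Z) : worstTrans p Z r h s a = p h s a := by
  simp [worstTrans, hz]

lemma robustValue_last (p : Trans S A H) (Z : Set (S × A × Fin H)) (r : Reward S A H) (s : S) :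
    robustValue p Z r H s = 0 := by
  rw [robustValue]; simp

lemma next_worstTrans_of_notMem (p : Trans S A H) {Z : Set (S × A × Fin H)} (r : Reward S A H)
    {h : Fin H} {s : S} {a : A} (hz : (s, a, h) ∉ Z) :
    next (worstTrans p Z r) (robustValue p Z r) h s a = ⨆ s', robustValue p Z r (h.1 + 1) s' := by
  classical
  simp only [next, worstTrans, hz, if_false]
  exact (sum_vertex_mul _ (robustValue p Z r (h.1 + 1))).trans
    (exists_eq_ciSup_of_finite (f := fun s' => robustValue p Z r (h.1 + 1) s')).choose_spec

lemma robustValue_eq (p : Trans S A H) (Z : Set (S × A × Fin H)) (r : Reward S A H)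
    (h : Fin H) (s : S) :
    robustValue p Z r h.1 s =
      ⨆ a, (r h (s, a) + next (worstTrans p Z r) (robustValue p Z r) h s a) := by
  rw [robustValue, dif_pos h.2]
  congr 1
  funext a
  congr 1
  by_cases hz : (s, a, h) ∈ Z
  · simp [hz, next, worstTrans]
  · rw [next_worstTrans_of_notMem p r hz]
    simp [hz]

lemma robustValue_isOptimal (p : Trans S A H) (Z : Set (S × A × Fin H)) (r : Reward S A H) :
    IsOptimal (worstTrans p Z r) r (robustValue p Z r) where
  last := robustValue_last p Z r
  le h s a := by
    rw [robustValue_eq p Z r h s]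
    exact le_ciSup (f := fun a => r h (s, a) + next (worstTrans p Z r) (robustValue p Z r) h s a)
      (Set.finite_range _).bddAbove a
  attained h s := by
    rw [robustValue_eq p Z r h s]
    obtain ⟨a, ha⟩ := exists_eq_ciSup_of_finite
      (f := fun a => r h (s, a) + next (worstTrans p Z r) (robustValue p Z r) h s a)
    exact ⟨a, ha.symm⟩

/-- Outside `Z` the worst model jumps to a maximiser of the next value, so it dominates every other
model there; this makes the robust value a common supersolution. -/
lemma next_le_worstTrans (p q : Trans S A H) {Z : Set (S × A × Fin H)} (r : Reward S A H)
    {h : Fin H} {s : S} {a : A} (hz : (s, a, h) ∉ Z) :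
    next q (robustValue p Z r) h s a ≤ next (worstTrans p Z r) (robustValue p Z r) h s a := by
  rw [next_worstTrans_of_notMem p r hz]
  exact sum_mul_le_of_le _ fun s' => le_ciSup (f := fun s' => robustValue p Z r (h.1 + 1) s')
    (Set.finite_range _).bddAbove s'

lemma abs_robustValue_le (p : Trans S A H) (Z : Set (S × A × Fin H)) (r : Reward S A H)
    (h : ℕ) (hh : h ≤ H) (s : S) : |robustValue p Z r h s| ≤ (H - h : ℝ) * ‖r‖ := by
  induction hk : H - h generalizing h s with
  | zero =>
    obtain rfl : h = H := by omega
    simp [robustValue_last]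
  | succ k ih =>
    have hlt : h < H := by omega
    obtain ⟨a, ha⟩ := (robustValue_isOptimal p Z r).attained ⟨h, hlt⟩ s
    simp only at ha
    rw [ha]
    have h1 : |r ⟨h, hlt⟩ (s, a)| ≤ ‖r‖ :=
      (norm_le_pi_norm (r ⟨h, hlt⟩) (s, a)).trans (norm_le_pi_norm r _)
    have h2 : |next (worstTrans p Z r) (robustValue p Z r) ⟨h, hlt⟩ s a| ≤
        (H - (h + 1 : ℕ) : ℝ) * ‖r‖ :=
      abs_sum_mul_le _ fun s' => ih (h + 1) (by omega) s' (by omega)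
    refine (abs_add_le _ _).trans ((add_le_add h1 h2).trans (le_of_eq ?_))
    push_cast
    ring

end Robust

/-! ### Moving a reward from one model to another. -/

section Transfer

variable {S A : Type*} [Fintype S] [Fintype A] {H : ℕ}

open Classical in
/-- The reward that makes `V` satisfy under `q` the Bellman relations which it satisfies under `p`
and `r`, where `p` and `q` differ on `Z` only. -/
noncomputable def shiftReward (p q : Trans S A H) (Z : Set (S × A × Fin H)) (r : Reward S A H)
    (V : ℕ → S → ℝ) : Reward S A H :=
  fun h x => r h x + if (x.1, x.2, h) ∈ Z then next p V h x.1 x.2 - next q V h x.1 x.2 else 0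

lemma shiftReward_of_mem (p q : Trans S A H) {Z : Set (S × A × Fin H)} (r : Reward S A H)
    (V : ℕ → S → ℝ) {h : Fin H} {s : S} {a : A} (hz : (s, a, h) ∈ Z) :
    shiftReward p q Z r V h (s, a) = r h (s, a) + (next p V h s a - next q V h s a) := by
  simp [shiftReward, hz]

lemma shiftReward_of_notMem (p q : Trans S A H) {Z : Set (S × A × Fin H)} (r : Reward S A H)
    (V : ℕ → S → ℝ) {h : Fin H} {s : S} {a : A} (hz : (s, a, h) ∉ Z) :
    shiftReward p q Z r V h (s, a) = r h (s, a) := by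
  simp [shiftReward, hz]

lemma dInf_comm (r r' : Reward S A H) : dInf r r' = dInf r' r := by
  simp only [dInf, max_comm ‖r‖ ‖r'‖]
  congr 1
  exact Finset.sum_congr rfl fun h _ => norm_sub_rev _ _

lemma dInf_shiftReward_le {p q : Trans S A H} {Z : Set (S × A × Fin H)} {r : Reward S A H}
    {V : ℕ → S → ℝ} (hlast : ∀ s, V H s = 0) (hV : ∀ h ≤ H, ∀ s, |V h s| ≤ H * ‖r‖) {t : ℝ}
    (ht : 0 ≤ t) (hpq : ∀ s a h, (s, a, h) ∈ Z → h.1 + 1 < H →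
      ∑ s', |p h s a s' - q h s a s'| ≤ t) :
    dInf r (shiftReward p q Z r V) ≤ H ^ 2 * t := by
  have hbound : ∀ h : Fin H, ‖r h - shiftReward p q Z r V h‖ ≤ t * (H * ‖r‖) := by
    intro h
    rw [pi_norm_le_iff_of_nonneg (by positivity)]
    rintro ⟨s, a⟩
    rw [Pi.sub_apply]
    by_cases hz : (s, a, h) ∈ Z
    · rw [shiftReward_of_mem p q r V hz, sub_add_cancel_left, norm_neg, Real.norm_eq_abs]
      by_cases hn : h.1 + 1 < H
      -- Before the last stage, Hölder's inequality pairs the `L¹` error of the model with the sup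
      -- bound on `V`; at the last stage there is no error because `V` vanishes at `H`.
      · rw [next, next, ← Finset.sum_sub_distrib]
        simp only [← sub_mul]
        calc |∑ s', (p h s a s' - q h s a s') * V (h.1 + 1) s'|
            ≤ ∑ s', |(p h s a s' - q h s a s') * V (h.1 + 1) s'| :=
              Finset.abs_sum_le_sum_abs _ _
          _ ≤ ∑ s', |p h s a s' - q h s a s'| * (H * ‖r‖) := by
              refine Finset.sum_le_sum fun s' _ => ?_
              rw [abs_mul]
              exact mul_le_mul_of_nonneg_left (hV _ hn.le s') (abs_nonneg _)
          _ ≤ t * (H * ‖r‖) := by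
              rw [← Finset.sum_mul]
              exact mul_le_mul_of_nonneg_right (hpq s a h hz hn) (by positivity)
      · rw [next_of_last p hlast hn, next_of_last q hlast hn]
        simp only [sub_zero, abs_zero]
        positivity
    · rw [shiftReward_of_notMem p q r V hz, sub_self, norm_zero]
      positivity
  have hsum : ∑ h, ‖r h - shiftReward p q Z r V h‖ ≤ H ^ 2 * t * ‖r‖ := by
    calc ∑ h, ‖r h - shiftReward p q Z r V h‖ ≤ ∑ _h : Fin H, t * (H * ‖r‖) :=
          Finset.sum_le_sum fun h _ => hbound h
      _ = H ^ 2 * t * ‖r‖ := by simp; ring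
  refine div_le_of_le_mul₀ (le_max_of_le_left (norm_nonneg _)) (by positivity) ?_
  exact hsum.trans (mul_le_mul_of_nonneg_left (le_max_left _ _) (by positivity))

/-- Transition models that agree with `p` on `Z` before the last stage. -/
def preClass (p : Trans S A H) (Z : Set (S × A × Fin H)) : Set (Trans S A H) :=
  {p' | ∀ s a h, (s, a, h) ∈ Z → h.1 + 1 < H → p' h s a = p h s a}

lemma transClass_subset_preClass (p : Trans S A H) (Z : Set (S × A × Fin H)) :
    transClass p Z ⊆ preClass p Z := fun _ hp' s a h hz _ => hp' s a h hz

lemma IsClosedUnder.congr {p p' : Trans S A H} {Z : Set (S × A × Fin H)} {π : DetPolicy S A H}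
    {X : Set (S × Fin H)} (hX : IsClosedUnder p π X)
    (hXZ : ∀ s h, (s, h) ∈ X → (s, π h s, h) ∈ Z) (hp' : p' ∈ preClass p Z) :
    IsClosedUnder p' π X := by
  intro s h hs hn s' hp
  rw [hp' s _ h (hXZ s h hs) hn] at hp
  exact hX s h hs hn s' hp

lemma next_congr_preClass {p p' : Trans S A H} {Z : Set (S × A × Fin H)} (hp' : p' ∈ preClass p Z)
    {V : ℕ → S → ℝ} (hlast : ∀ s, V H s = 0) {s : S} {a : A} {h : Fin H} (hz : (s, a, h) ∈ Z) :
    next p' V h s a = next p V h s a := by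
  by_cases hn : h.1 + 1 < H
  · rw [next, next, hp' s a h hz hn]
  · rw [next_of_last _ hlast hn, next_of_last _ hlast hn]

variable [Nonempty S] [Nonempty A]

lemma robustValue_bound (p : Trans S A H) (Z : Set (S × A × Fin H)) (r : Reward S A H)
    (h : ℕ) (hh : h ≤ H) (s : S) : |robustValue p Z r h s| ≤ H * ‖r‖ :=
  (abs_robustValue_le p Z r h hh s).trans
    (mul_le_mul_of_nonneg_right (by linarith [(Nat.cast_nonneg h : (0 : ℝ) ≤ h)]) (norm_nonneg _))

variable {p q : Trans S A H} {Z : Set (S × A × Fin H)} {π : DetPolicy S A H}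
  {X : Set (S × Fin H)} {t : ℝ}

/-- The hypothesis ranges over the smaller class of models and the conclusion over the larger one,
so the lemma serves both directions of the Hausdorff distance with `p` and `q` exchanged. -/
lemma exists_near_inter (hX : IsClosedUnder q π X) (hXZ : ∀ s h, (s, h) ∈ X → (s, π h s, h) ∈ Z)
    (ht : 0 ≤ t) (hpq : ∀ s a h, (s, a, h) ∈ Z → h.1 + 1 < H →
      ∑ s', |p h s a s' - q h s a s'| ≤ t) {r : Reward S A H}
    (hr : ∀ p' ∈ transClass p Z, r ∈ feasibleOn p' π X) :
    ∃ r', (∀ q' ∈ preClass q Z, r' ∈ feasibleOn q' π X) ∧ dInf r r' ≤ H ^ 2 * t := by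
  set V := robustValue p Z r with hVdef
  have hopt := robustValue_isOptimal p Z r
  -- Only the worst model is used: its Bellman equation on `X` involves `Z` alone, hence is shared
  -- by all completions.
  have hB := hopt.bellmanOn (hr _ fun s a h hz => worstTrans_of_mem p r hz)
  refine ⟨shiftReward p q Z r V, fun q' hq' => ?_,
    dInf_shiftReward_le hopt.last (robustValue_bound p Z r) ht hpq⟩
  have hnext : ∀ s a h, (s, a, h) ∈ Z → shiftReward p q Z r V h (s, a) + next q' V h s a =
      r h (s, a) + next (worstTrans p Z r) V h s a := by
    intro s a h hz
    rw [shiftReward_of_mem p q r V hz, next_congr_preClass hq' hopt.last hz,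
      next, next, next, worstTrans_of_mem p r hz]
    ring
  refine mem_feasibleOn_of_isSuperSol (V := V) ⟨hopt.last, fun h s a => ?_⟩ ?_ (hX.congr hXZ hq')
  · by_cases hz : (s, a, h) ∈ Z
    · rw [hnext s a h hz]
      exact hopt.le h s a
    · rw [shiftReward_of_notMem p q r V hz]
      exact (add_le_add le_rfl (next_le_worstTrans p q' r hz)).trans (hopt.le h s a)
  · intro s h hs
    rw [hnext s _ h (hXZ s h hs)]
    exact hB s h hs

/-- Here `V` is the ordinary optimal value of the witness `p'`. The new witness copies `q` on `Z`
and `p'` elsewhere, and the shifted reward leaves all Bellman backups of `V` unchanged. -/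
lemma exists_near_union (hX : IsClosedUnder q π X) (hXZ : ∀ s h, (s, h) ∈ X → (s, π h s, h) ∈ Z)
    (ht : 0 ≤ t) (hpq : ∀ s a h, (s, a, h) ∈ Z → h.1 + 1 < H →
      ∑ s', |p h s a s' - q h s a s'| ≤ t) {r : Reward S A H}
    (hr : ∃ p' ∈ preClass p Z, r ∈ feasibleOn p' π X) :
    ∃ r', (∃ q' ∈ transClass q Z, r' ∈ feasibleOn q' π X) ∧ dInf r r' ≤ H ^ 2 * t := by
  classical
  obtain ⟨p', hp', hr⟩ := hr
  set V := robustValue p' Set.univ r with hVdef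
  -- With `Z = univ` nothing is free, and the robust value is the ordinary optimal value.
  have hw : worstTrans p' Set.univ r = p' := by
    funext h s a
    exact worstTrans_of_mem p' r (Set.mem_univ _)
  have hopt := robustValue_isOptimal p' Set.univ r
  rw [hw] at hopt
  have hB := hopt.bellmanOn hr
  set q' : Trans S A H := fun h s a => if (s, a, h) ∈ Z then q h s a else p' h s a with hq'def
  have hq' : q' ∈ transClass q Z := fun s a h hz => by simp [hq'def, hz]
  have hnext : ∀ s a h, shiftReward p q Z r V h (s, a) + next q' V h s a =
      r h (s, a) + next p' V h s a := by
    intro s a h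
    by_cases hz : (s, a, h) ∈ Z
    · rw [shiftReward_of_mem p q r V hz, next_congr_preClass hp' hopt.last hz]
      simp only [next, hq' s a h hz]
      ring
    · rw [shiftReward_of_notMem p q r V hz]
      simp [next, hq'def, hz]
  refine ⟨shiftReward p q Z r V, ⟨q', hq', ?_⟩,
    dInf_shiftReward_le hopt.last (robustValue_bound p' _ r) ht hpq⟩
  refine mem_feasibleOn_of_isSuperSol (V := V) ⟨hopt.last, fun h s a => ?_⟩ ?_
    (hX.congr hXZ (transClass_subset_preClass _ _ hq'))
  · rw [hnext]
    exact hopt.le h s a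
  · intro s h hs
    rw [hnext]
    exact hB s h hs

/-- Both sides are equivalent to the Bellman equation of `π` on `X` for the optimal value function.
-/
lemma feasible_eq_feasibleOn [NeZero H] {μ₀ : stdSimplex ℝ S} (hX : IsReach μ₀ p π X) :
    feasible μ₀ p π = feasibleOn p π X := by
  have hw : ∀ r, worstTrans p Set.univ r = p := by
    intro r
    funext h s a
    exact worstTrans_of_mem p r (Set.mem_univ _)
  ext r
  have hopt := robustValue_isOptimal p Set.univ r
  rw [hw] at hopt
  exact ⟨fun hr => mem_feasibleOn_of_isSuperSol hopt.toIsSuperSol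
      (hopt.bellmanOn_of_feasible hX hr) hX.closed,
    fun hr => mem_feasible_of_isSuperSol hopt.toIsSuperSol (hopt.bellmanOn hr) hX⟩

end Transfer

/-! ### Marginals of Markov chain path weights. -/

section Chain

variable {T : Type*} [Fintype T]

/-- Weight of a path of a Markov chain with initial weights `ν` and kernels `K`. -/
noncomputable def chainProb (ν : T → ℝ) (K : ℕ → T → T → ℝ) (n : ℕ) (ω : Fin n → T) : ℝ :=
  ∏ i : Fin n, if i.1 = 0 then ν (ω i) else K i (ω ⟨i.1 - 1, by omega⟩) (ω i)

lemma sum_fin_succ_fun {n : ℕ} (F : (Fin (n + 1) → T) → ℝ) :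
    ∑ ω, F ω = ∑ ω : Fin n → T, ∑ x, F (Fin.snoc ω x) := by
  rw [← (Fin.snocEquiv fun _ : Fin (n + 1) => T).sum_comp, Fintype.sum_prod_type,
    Finset.sum_comm]
  rfl

lemma chainProb_snoc (ν : T → ℝ) (K : ℕ → T → T → ℝ) (n : ℕ) (ω : Fin n → T) (x : T) :
    chainProb ν K (n + 1) (Fin.snoc ω x) = chainProb ν K n ω *
      if hn : n = 0 then ν x else K n (ω ⟨n - 1, by omega⟩) x := by
  rw [chainProb, Fin.prod_univ_castSucc, chainProb]
  congr 1
  · refine Finset.prod_congr rfl fun i _ => ?_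
    have h1 : (Fin.snoc ω x : Fin (n + 1) → T) i.castSucc = ω i :=
      Fin.snoc_castSucc (α := fun _ => T) _ _ _
    have h2 : (Fin.snoc ω x : Fin (n + 1) → T) ⟨i.1 - 1, by omega⟩ = ω ⟨i.1 - 1, by omega⟩ :=
      Fin.snoc_castSucc (α := fun _ => T) x ω ⟨i.1 - 1, by omega⟩
    simp only [Fin.val_castSucc, h1, h2]
  · have h1 : (Fin.snoc ω x : Fin (n + 1) → T) (Fin.last n) = x :=
      Fin.snoc_last (α := fun _ => T) _ _
    simp only [Fin.val_last, h1]
    split_ifs with hn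
    · rfl
    · congr 1
      exact Fin.snoc_castSucc (α := fun _ => T) x ω ⟨n - 1, by omega⟩

variable {ν : T → ℝ} {K : ℕ → T → T → ℝ}

/-- Steps after the `m`-th sum to one and can be peeled off from the end. Kernels are normalised
only for `0 < n < H`, the range in which `saKernel` is a genuine transition. -/
lemma sum_chainProb_castLE {H : ℕ} (hν : ∑ x, ν x = 1)
    (hK : ∀ n x, 0 < n → n < H → ∑ y, K n x y = 1) {m n : ℕ} (hmn : m ≤ n) (hn : n ≤ H)
    (f : (Fin m → T) → ℝ) :
    ∑ ω, chainProb ν K n ω * f (fun i => ω (Fin.castLE hmn i)) = ∑ ω, chainProb ν K m ω * f ω := by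
  induction n, hmn using Nat.le_induction with
  | base => rfl
  | succ n hmn ih =>
    rw [← ih (by omega), sum_fin_succ_fun]
    refine Finset.sum_congr rfl fun ω _ => ?_
    have h1 : ∀ x, (fun i : Fin m =>
        (Fin.snoc ω x : Fin (n + 1) → T) (Fin.castLE (hmn.trans n.le_succ) i)) =
        fun i => ω (Fin.castLE hmn i) := by
      intro x
      funext i
      exact Fin.snoc_castSucc (α := fun _ => T) x ω (Fin.castLE hmn i)
    simp only [h1, chainProb_snoc, mul_assoc]
    rw [← Finset.mul_sum, ← Finset.sum_mul]
    split_ifs with h0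
    · rw [hν, one_mul]
    · rw [hK n _ (by omega) (by omega), one_mul]

lemma sum_chainProb_zero {H : ℕ} (hν : ∑ x, ν x = 1)
    (hK : ∀ n x, 0 < n → n < H → ∑ y, K n x y = 1) (hH : 0 < H) (f : T → ℝ) :
    ∑ ω : Fin H → T, chainProb ν K H ω * f (ω ⟨0, hH⟩) = ∑ x, ν x * f x := by
  have := sum_chainProb_castLE hν hK (m := 1) (n := H) hH le_rfl (fun ω => f (ω 0))
  refine this.trans ?_
  rw [sum_fin_succ_fun, Fintype.sum_unique]
  refine Finset.sum_congr rfl fun x _ => ?_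
  rw [chainProb_snoc]
  simp [chainProb, Fin.snoc]

lemma sum_chainProb_succ {H : ℕ} (hν : ∑ x, ν x = 1)
    (hK : ∀ n x, 0 < n → n < H → ∑ y, K n x y = 1) {h : ℕ} (hn : h + 1 < H) (f : T → T → ℝ) :
    ∑ ω : Fin H → T, chainProb ν K H ω * f (ω ⟨h, by omega⟩) (ω ⟨h + 1, hn⟩) =
      ∑ ω : Fin H → T, chainProb ν K H ω *
        ∑ y, K (h + 1) (ω ⟨h, by omega⟩) y * f (ω ⟨h, by omega⟩) y := by
  have h1 := sum_chainProb_castLE hν hK (m := h + 2) (n := H) hn le_rfl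
    (fun ω => f (ω ⟨h, by omega⟩) (ω ⟨h + 1, by omega⟩))
  have h2 := sum_chainProb_castLE hν hK (m := h + 1) (n := H) (by omega) le_rfl
    (fun ω => ∑ y, K (h + 1) (ω ⟨h, by omega⟩) y * f (ω ⟨h, by omega⟩) y)
  refine h1.trans (Eq.trans ?_ h2.symm)
  rw [sum_fin_succ_fun]
  refine Finset.sum_congr rfl fun ω _ => ?_
  rw [Finset.mul_sum]
  refine Finset.sum_congr rfl fun x _ => ?_
  rw [chainProb_snoc, dif_neg (by omega), mul_assoc]
  have e1 : (Fin.snoc ω x : Fin (h + 1 + 1) → T) ⟨h, by omega⟩ = ω ⟨h, by omega⟩ :=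
    Fin.snoc_castSucc (α := fun _ => T) x ω ⟨h, by omega⟩
  have e2 : (Fin.snoc ω x : Fin (h + 1 + 1) → T) ⟨h + 1, by omega⟩ = x :=
    Fin.snoc_last (α := fun _ => T) _ _
  rw [e1, e2]
  rfl

end Chain

/-! ### Visitation distributions and the Markov property. -/

section Visits

variable {S A : Type*} [Fintype S] [Fintype A] {H : ℕ}

/-- Transition kernel on state-action pairs into stage `n`. -/
noncomputable def saKernel (p : Trans S A H) (π : Policy S A H) (n : ℕ) (x y : S × A) : ℝ :=
  if hn : n < H then p ⟨n - 1, by omega⟩ x.1 x.2 y.1 * π ⟨n, hn⟩ y.1 y.2 else 0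

lemma trajProb_nonneg (μ₀ : stdSimplex ℝ S) (p : Trans S A H) (π : Policy S A H)
    (ω : Traj S A H) : 0 ≤ trajProb μ₀ p π ω := by
  refine Finset.prod_nonneg fun h _ => mul_nonneg ?_ (stdSimplex.zero_le _ _)
  split_ifs
  · exact stdSimplex.zero_le _ _
  · exact stdSimplex.zero_le _ _

variable [NeZero H] (μ₀ : stdSimplex ℝ S) (p : Trans S A H) (π : Policy S A H)

lemma trajProb_eq_chainProb (ω : Traj S A H) :
    trajProb μ₀ p π ω =
      chainProb (fun y => μ₀ y.1 * π 0 y.1 y.2) (saKernel p π) H ω := by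
  refine Finset.prod_congr rfl fun h _ => ?_
  by_cases h0 : h.1 = 0
  · obtain rfl : h = 0 := Fin.ext h0
    simp
  · simp [h0, saKernel]

lemma sum_prod_mul (q : stdSimplex ℝ S) (κ : S → stdSimplex ℝ A) (f : S × A → ℝ) :
    ∑ y : S × A, q y.1 * κ y.1 y.2 * f y = ∑ s, q s * ∑ a, κ s a * f (s, a) := by
  rw [Fintype.sum_prod_type]
  simp only [Finset.mul_sum, mul_assoc]

lemma sum_init : ∑ y : S × A, μ₀ y.1 * π 0 y.1 y.2 = 1 := by
  simpa using sum_prod_mul μ₀ (π 0) fun _ => 1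

lemma sum_saKernel (n : ℕ) (x : S × A) (_ : 0 < n) (hn : n < H) :
    ∑ y, saKernel p π n x y = 1 := by
  simpa [saKernel, hn] using sum_prod_mul (p ⟨n - 1, by omega⟩ x.1 x.2) (π ⟨n, hn⟩) fun _ => 1

lemma sum_trajProb_mul_zero (f : S × A → ℝ) :
    ∑ ω, trajProb μ₀ p π ω * f (ω 0) = ∑ s, μ₀ s * ∑ a, π 0 s a * f (s, a) := by
  simp only [trajProb_eq_chainProb]
  exact (sum_chainProb_zero (sum_init μ₀ π) (sum_saKernel p π) (NeZero.pos H) f).trans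
    (sum_prod_mul μ₀ (π 0) f)

lemma sum_trajProb : ∑ ω, trajProb μ₀ p π ω = 1 := by
  simpa using sum_trajProb_mul_zero μ₀ p π fun _ => 1

lemma sum_trajProb_mul_succ {h : Fin H} (hn : h.1 + 1 < H) (f : S × A → S × A → ℝ) :
    ∑ ω, trajProb μ₀ p π ω * f (ω h) (ω ⟨h.1 + 1, hn⟩) =
      ∑ ω, trajProb μ₀ p π ω * ∑ s', p h (ω h).1 (ω h).2 s' *
        ∑ a', π ⟨h.1 + 1, hn⟩ s' a' * f (ω h) (s', a') := by
  simp only [trajProb_eq_chainProb]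
  refine (sum_chainProb_succ (sum_init μ₀ π) (sum_saKernel p π) hn f).trans ?_
  refine Finset.sum_congr rfl fun ω _ => ?_
  congr 1
  rw [← sum_prod_mul]
  simp [saKernel, hn]

open Classical in
lemma visit_eq (h : Fin H) (s : S) (a : A) :
    visit μ₀ p π h s a = ∑ ω, trajProb μ₀ p π ω * if ω h = (s, a) then 1 else 0 := by
  simp [visit]

lemma visit_nonneg (h : Fin H) (s : S) (a : A) : 0 ≤ visit μ₀ p π h s a := by
  classical
  exact Finset.sum_nonneg fun ω _ => by
    split_ifs
    · exact trajProb_nonneg _ _ _ _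
    · exact le_rfl

lemma sum_visit_mul (h : Fin H) (g : S × A → ℝ) :
    ∑ s, ∑ a, visit μ₀ p π h s a * g (s, a) = ∑ ω, trajProb μ₀ p π ω * g (ω h) := by
  classical
  simp only [visit_eq, Finset.sum_mul]
  rw [← Fintype.sum_prod_type' (f := fun s a => ∑ ω, trajProb μ₀ p π ω *
    (if ω h = (s, a) then 1 else 0) * g (s, a)), Finset.sum_comm]
  refine Finset.sum_congr rfl fun ω _ => ?_
  simp

lemma sum_visit (h : Fin H) : ∑ s, ∑ a, visit μ₀ p π h s a = 1 := by
  simpa [sum_trajProb] using sum_visit_mul μ₀ p π h fun _ => 1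

lemma visit_zero (s : S) (a : A) : visit μ₀ p π 0 s a = μ₀ s * π 0 s a := by
  classical
  rw [visit_eq, sum_trajProb_mul_zero μ₀ p π fun x => if x = (s, a) then 1 else 0]
  simp [Prod.ext_iff, ite_and]

lemma visit_succ {h : Fin H} (hn : h.1 + 1 < H) (s' : S) (a' : A) :
    visit μ₀ p π ⟨h.1 + 1, hn⟩ s' a' =
      (∑ s, ∑ a, visit μ₀ p π h s a * p h s a s') * π ⟨h.1 + 1, hn⟩ s' a' := by
  classical
  rw [visit_eq, sum_trajProb_mul_succ μ₀ p π hn fun _ y => if y = (s', a') then 1 else 0,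
    sum_visit_mul μ₀ p π h fun x => p h x.1 x.2 s', Finset.sum_mul]
  refine Finset.sum_congr rfl fun ω _ => ?_
  rw [mul_assoc]
  simp [Prod.ext_iff, ite_and]

lemma visitState_zero (s : S) : visitState μ₀ p π 0 s = μ₀ s := by
  simp [visitState, visit_zero, ← Finset.mul_sum]

lemma visitState_succ {h : Fin H} (hn : h.1 + 1 < H) (s' : S) :
    visitState μ₀ p π ⟨h.1 + 1, hn⟩ s' = ∑ s, ∑ a, visit μ₀ p π h s a * p h s a s' := by
  simp [visitState, visit_succ, ← Finset.mul_sum]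

lemma visit_eq_visitState_mul (h : Fin H) (s : S) (a : A) :
    visit μ₀ p π h s a = visitState μ₀ p π h s * π h s a := by
  obtain ⟨n, hn⟩ := h
  cases n with
  | zero =>
    have h0 : (⟨0, hn⟩ : Fin H) = 0 := rfl
    rw [h0, visit_zero, visitState_zero]
  | succ n =>
    have h1 := visit_succ μ₀ p π (h := ⟨n, by omega⟩) hn s a
    have h2 := visitState_succ μ₀ p π (h := ⟨n, by omega⟩) hn s
    simp only at h1 h2
    rw [h1, h2]

open Classical in
lemma sum_trajProb_transition {h : Fin H} (hn : h.1 + 1 < H) (s : S) (a : A) (f : S → ℝ) :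
    ∑ ω, trajProb μ₀ p π ω * (if ω h = (s, a) then f (ω ⟨h.1 + 1, hn⟩).1 else 0) =
      visit μ₀ p π h s a * ∑ s', p h s a s' * f s' := by
  rw [sum_trajProb_mul_succ μ₀ p π hn fun x y => if x = (s, a) then f y.1 else 0, visit_eq,
    Finset.sum_mul]
  refine Finset.sum_congr rfl fun ω _ => ?_
  rw [mul_assoc]
  congr 1
  split_ifs with hω
  · simp [hω, ← Finset.sum_mul]
  · simp

lemma visit_pos_of_trajProb_pos {ω : Traj S A H} (hω : 0 < trajProb μ₀ p π ω) (h : Fin H) :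
    0 < visit μ₀ p π h (ω h).1 (ω h).2 := by
  classical
  rw [visit_eq]
  refine hω.trans_le ?_
  refine le_trans (by simp) (Finset.single_le_sum (f := fun ω' => trajProb μ₀ p π ω' *
    if ω' h = ((ω h).1, (ω h).2) then (1 : ℝ) else 0) (fun ω' _ => ?_) (Finset.mem_univ ω))
  exact mul_nonneg (trajProb_nonneg _ _ _ _) (by positivity)

lemma visitState_nonneg (h : Fin H) (s : S) : 0 ≤ visitState μ₀ p π h s :=
  Finset.sum_nonneg fun a _ => visit_nonneg μ₀ p π h s a

lemma visit_le_visitState (h : Fin H) (s : S) (a : A) :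
    visit μ₀ p π h s a ≤ visitState μ₀ p π h s :=
  Finset.single_le_sum (f := fun a => visit μ₀ p π h s a) (fun a _ => visit_nonneg μ₀ p π h s a)
    (Finset.mem_univ a)

lemma visitState_succ_pos {h : Fin H} (hn : h.1 + 1 < H) (s' : S) :
    0 < visitState μ₀ p π ⟨h.1 + 1, hn⟩ s' ↔
      ∃ s a, 0 < visit μ₀ p π h s a ∧ 0 < p h s a s' := by
  rw [visitState_succ]
  have hnn : ∀ s a, 0 ≤ visit μ₀ p π h s a * p h s a s' := fun s a =>
    mul_nonneg (visit_nonneg _ _ _ _ _ _) (stdSimplex.zero_le _ _)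
  constructor
  · intro hpos
    obtain ⟨s, -, hs⟩ := Finset.exists_lt_of_sum_lt (s := Finset.univ) (f := fun _ : S => (0 : ℝ))
      (g := fun s => ∑ a, visit μ₀ p π h s a * p h s a s') (by simpa using hpos)
    obtain ⟨a, -, ha⟩ := Finset.exists_lt_of_sum_lt (s := Finset.univ) (f := fun _ : A => (0 : ℝ))
      (g := fun a => visit μ₀ p π h s a * p h s a s') (by simpa using hs)
    exact ⟨s, a, pos_of_mul_pos_left ha (stdSimplex.zero_le _ _),
      pos_of_mul_pos_right ha (visit_nonneg _ _ _ _ _ _)⟩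
  · rintro ⟨s, a, h1, h2⟩
    refine Finset.sum_pos' (fun s _ => Finset.sum_nonneg fun a _ => hnn s a)
      ⟨s, Finset.mem_univ _, Finset.sum_pos' (fun a _ => hnn s a)
        ⟨a, Finset.mem_univ _, mul_pos h1 h2⟩⟩

lemma toPolicy_pos_iff (πE : DetPolicy S A H) (h : Fin H) (s : S) (a : A) :
    0 < πE.toPolicy h s a ↔ a = πE h s := by
  classical
  have := sum_toPolicy_mul πE h s fun a' => if a' = a then 1 else 0
  simp only [mul_ite, mul_one, mul_zero, Finset.sum_ite_eq', Finset.mem_univ, if_true] at this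
  rw [this]
  by_cases ha : πE h s = a
  · simp [ha]
  · simp [ha, Ne.symm ha]

lemma visit_toPolicy_pos_iff (πE : DetPolicy S A H) (h : Fin H) (s : S) (a : A) :
    0 < visit μ₀ p πE.toPolicy h s a ↔ (s, h) ∈ stateSupport μ₀ p πE.toPolicy ∧ a = πE h s := by
  rw [visit_eq_visitState_mul, ← toPolicy_pos_iff πE h s a]
  refine ⟨fun hpos => ⟨pos_of_mul_pos_left hpos (stdSimplex.zero_le _ _),
    pos_of_mul_pos_right hpos (visitState_nonneg _ _ _ _ _)⟩, fun hpos => mul_pos hpos.1 hpos.2⟩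

lemma isReach_stateSupport (πE : DetPolicy S A H) :
    IsReach μ₀ p πE (stateSupport μ₀ p πE.toPolicy) where
  init s := by
    change 0 < visitState μ₀ p πE.toPolicy 0 s ↔ _
    rw [visitState_zero]
  closed s h hs hn s' hp := (visitState_succ_pos μ₀ p πE.toPolicy hn s').2
    ⟨s, πE h s, (visit_toPolicy_pos_iff μ₀ p πE h s _).2 ⟨hs, rfl⟩, hp⟩
  pred h hn s' hs' := by
    obtain ⟨s, a, h1, h2⟩ := (visitState_succ_pos μ₀ p πE.toPolicy hn s').1 hs'
    obtain ⟨h3, rfl⟩ := (visit_toPolicy_pos_iff μ₀ p πE h s _).1 h1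
    exact ⟨s, h3, h2⟩

-- The recursion that defines reachability reads the model only along expert actions, which lie in
-- `Z`.
variable {μ₀ p} in
lemma IsReach.congr {p' : Trans S A H} {Z : Set (S × A × Fin H)} {πE : DetPolicy S A H}
    {X : Set (S × Fin H)} (hX : IsReach μ₀ p πE X)
    (hXZ : ∀ s h, (s, h) ∈ X → (s, πE h s, h) ∈ Z) (hp' : p' ∈ preClass p Z) :
    IsReach μ₀ p' πE X where
  init := hX.init
  closed := hX.closed.congr hXZ hp'
  pred h hn s' hs' := by
    obtain ⟨s, hs, hp⟩ := hX.pred h hn s' hs'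
    exact ⟨s, hs, by rwa [hp' s _ h (hXZ s h hs) hn]⟩

-- Induction along expert paths: at each reached state the behavioral policy plays the expert's
-- action with positive probability, so it also reaches the successors.
variable {μ₀ p π} in
lemma Covers.mem_saSupport {πE : DetPolicy S A H} (hc : Covers μ₀ p πE π) (s : S) (h : Fin H)
    (hs : (s, h) ∈ stateSupport μ₀ p πE.toPolicy) : (s, πE h s, h) ∈ saSupport μ₀ p π := by
  have hX := isReach_stateSupport μ₀ p πE
  suffices key : ∀ n (hn : n < H) s, (s, (⟨n, hn⟩ : Fin H)) ∈ stateSupport μ₀ p πE.toPolicy →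
      0 < visitState μ₀ p π ⟨n, hn⟩ s by
    change 0 < visit μ₀ p π h s (πE h s)
    rw [visit_eq_visitState_mul]
    exact mul_pos (key h.1 h.2 s hs) (hc s h hs)
  intro n
  induction n with
  | zero =>
    intro hn s hs
    have h0 : (⟨0, hn⟩ : Fin H) = 0 := rfl
    rw [h0] at hs ⊢
    rw [visitState_zero]
    exact (hX.init s).1 hs
  | succ n ih =>
    intro hn s' hs'
    obtain ⟨s, hs, hp⟩ := hX.pred ⟨n, by omega⟩ hn s' hs'
    refine (visitState_succ_pos μ₀ p π (h := ⟨n, by omega⟩) hn s').2 ⟨s, _, ?_, hp⟩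
    rw [visit_eq_visitState_mul]
    exact mul_pos (ih _ s hs) (hc s _ hs)

lemma trans_pos_of_trajProb_pos {ω : Traj S A H} (hω : 0 < trajProb μ₀ p π ω) (h : Fin H)
    (hn : h.1 + 1 < H) : 0 < p h (ω h).1 (ω h).2 (ω ⟨h.1 + 1, hn⟩).1 := by
  have := Finset.prod_ne_zero_iff.1 hω.ne' ⟨h.1 + 1, hn⟩ (Finset.mem_univ _)
  simp only [Nat.add_eq_zero_iff, one_ne_zero, and_false, if_false, Nat.add_sub_cancel] at this
  exact (stdSimplex.zero_le _ _).lt_of_ne' (left_ne_zero_of_mul this)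

end Visits

/-! ### Exponential inequalities for independent draws. -/

section Independent

variable {Ω : Type*} [Fintype Ω]

open Classical in
/-- Weight of the event `E` for `τ` independent draws from the weights `w`. -/
noncomputable def iidProb (w : Ω → ℝ) {τ : ℕ} (E : Set (Fin τ → Ω)) : ℝ :=
  ∑ D : Fin τ → Ω, if D ∈ E then ∏ i, w (D i) else 0

variable {w : Ω → ℝ} {τ : ℕ}

/-- Markov's inequality for a product of independent factors; exponential `f` gives Chernoff bounds.
-/
lemma iidProb_le_pow (hw : ∀ ω, 0 ≤ w ω) {f : Ω → ℝ} (hf : ∀ ω, 0 ≤ f ω)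
    {E : Set (Fin τ → Ω)} (hE : ∀ D ∈ E, 1 ≤ ∏ i, f (D i)) :
    iidProb w E ≤ (∑ ω, w ω * f ω) ^ τ := by
  rw [Fintype.sum_pow]
  refine Finset.sum_le_sum fun D _ => ?_
  rw [Finset.prod_mul_distrib]
  have h0 : 0 ≤ ∏ i, w (D i) := Finset.prod_nonneg fun i _ => hw _
  split_ifs with hD
  · exact le_mul_of_one_le_right h0 (hE D hD)
  · exact mul_nonneg h0 (Finset.prod_nonneg fun i _ => hf _)

lemma iidProb_biUnion_le (hw : ∀ ω, 0 ≤ w ω) {ι : Type*} (I : Finset ι)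
    (E : ι → Set (Fin τ → Ω)) :
    iidProb w {D | ∃ i ∈ I, D ∈ E i} ≤ ∑ i ∈ I, iidProb w (E i) := by
  classical
  unfold iidProb
  rw [Finset.sum_comm]
  refine Finset.sum_le_sum fun D _ => ?_
  have h0 : 0 ≤ ∏ i, w (D i) := Finset.prod_nonneg fun i _ => hw _
  have hnn : ∀ i ∈ I, 0 ≤ if D ∈ E i then ∏ i, w (D i) else 0 := fun i _ => by
    split_ifs
    · exact h0
    · exact le_rfl
  split_ifs with hD
  · obtain ⟨i, hi, hDi⟩ := hD
    refine le_trans ?_ (Finset.single_le_sum hnn hi)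
    rw [if_pos hDi]
  · exact Finset.sum_nonneg hnn

lemma iidProb_union_le (hw : ∀ ω, 0 ≤ w ω) (E F : Set (Fin τ → Ω)) :
    iidProb w (E ∪ F) ≤ iidProb w E + iidProb w F := by
  classical
  unfold iidProb
  rw [← Finset.sum_add_distrib]
  refine Finset.sum_le_sum fun D _ => ?_
  have h0 : 0 ≤ ∏ i, w (D i) := Finset.prod_nonneg fun i _ => hw _
  by_cases h1 : D ∈ E <;> by_cases h2 : D ∈ F <;> simp [h1, h2, h0]

lemma iidProb_univ (hw1 : ∑ ω, w ω = 1) : ∑ D : Fin τ → Ω, ∏ i, w (D i) = 1 := by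
  rw [← Fintype.sum_pow, hw1, one_pow]

lemma iidProb_few_le (hw : ∀ ω, 0 ≤ w ω) (hw1 : ∑ ω, w ω = 1) (P : Ω → Prop)
    [DecidablePred P] {v : ℝ}
    (hv : ∑ ω, w ω * (if P ω then 1 else 0) = v) :
    iidProb w {D : Fin τ → Ω | (∑ i, if P (D i) then 1 else 0 : ℝ) < τ * v / 2} ≤
      Real.exp (-(τ * v / 8)) := by
  have hv0 : 0 ≤ v := hv ▸ Finset.sum_nonneg fun ω _ => mul_nonneg (hw ω) (by positivity)
  refine (iidProb_le_pow hw (f := fun ω => Real.exp (v / 2 - if P ω then 1 else 0))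
    (fun ω => (Real.exp_pos _).le) ?_).trans ?_
  · intro D hD
    rw [← Real.exp_sum, Finset.sum_sub_distrib]
    apply Real.one_le_exp
    simp only [Set.mem_ofPred_eq] at hD
    simp only [Finset.sum_const, Finset.card_univ, Fintype.card_fin, nsmul_eq_mul]
    linarith
  -- Tilting by `exp (-1)` leaves the exponent `1/2 - (1 - exp (-1)) ≤ 1/2 - 5/8 = -1/8` per unit of
  -- `v`.
  · have he : Real.exp (-1) ≤ 3 / 8 := by
      rw [Real.exp_neg]
      have := Real.exp_one_gt_d9
      rw [inv_le_comm₀ (Real.exp_pos 1) (by norm_num)]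
      linarith
    have h1 : ∑ ω, w ω * Real.exp (v / 2 - if P ω then 1 else 0) =
        Real.exp (v / 2) * (1 - v * (1 - Real.exp (-1))) := by
      have h3 : ∀ ω, w ω * Real.exp (v / 2 - if P ω then 1 else 0) = Real.exp (v / 2) * w ω -
          Real.exp (v / 2) * (1 - Real.exp (-1)) * (w ω * if P ω then 1 else 0) := fun ω => by
        rw [sub_eq_add_neg, Real.exp_add]
        split_ifs
        · ring
        · rw [neg_zero, Real.exp_zero]
          ring
      simp only [h3]
      rw [Finset.sum_sub_distrib, ← Finset.mul_sum, ← Finset.mul_sum, hw1, hv]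
      ring
    have h2 : ∑ ω, w ω * Real.exp (v / 2 - if P ω then 1 else 0) ≤ Real.exp (-(v / 8)) := by
      rw [h1]
      calc Real.exp (v / 2) * (1 - v * (1 - Real.exp (-1)))
          ≤ Real.exp (v / 2) * Real.exp (-(v * (1 - Real.exp (-1)))) := by
            refine mul_le_mul_of_nonneg_left ?_ (Real.exp_pos _).le
            have := Real.add_one_le_exp (-(v * (1 - Real.exp (-1))))
            linarith
        _ ≤ Real.exp (-(v / 8)) := by
            rw [← Real.exp_add]
            apply Real.exp_le_exp.2
            nlinarith
    calc _ ≤ Real.exp (-(v / 8)) ^ τ := pow_le_pow_left₀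
          (Finset.sum_nonneg fun ω _ => mul_nonneg (hw ω) (Real.exp_pos _).le) h2 τ
      _ = Real.exp (-(τ * v / 8)) := by rw [← Real.exp_nat_mul]; congr 1; ring

/-- The summand vanishes off `P`, so its second moment is at most `4 v`. This Bernstein-type gain
makes the exponent linear in `v`, where Hoeffding's inequality would give `v ^ 2`. -/
lemma iidProb_deviation_le (hw : ∀ ω, 0 ≤ w ω) (hw1 : ∑ ω, w ω = 1) (P : Ω → Prop)
    [DecidablePred P] {v : ℝ}
    (hv : ∑ ω, w ω * (if P ω then 1 else 0) = v) {Y : Ω → ℝ} (hY : ∀ ω, |Y ω| ≤ 2)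
    (hmean : ∑ ω, w ω * (if P ω then Y ω else 0) = 0) {t : ℝ} (ht0 : 0 ≤ t) (ht1 : t ≤ 1) :
    iidProb w {D : Fin τ → Ω | τ * v * t ≤ ∑ i, if P (D i) then Y (D i) else 0} ≤
      Real.exp (-(τ * v * t ^ 2 / 16)) := by
  set X : Ω → ℝ := fun ω => if P ω then Y ω else 0 with hX
  -- The tilt `t / 8` minimises `-x v t + 4 x ^ 2 v` over `x`.
  refine (iidProb_le_pow hw (f := fun ω => Real.exp (t / 8 * X ω - t / 8 * (v * t)))
    (fun ω => (Real.exp_pos _).le) ?_).trans ?_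
  · intro D hD
    rw [← Real.exp_sum, Finset.sum_sub_distrib, ← Finset.mul_sum]
    apply Real.one_le_exp
    simp only [Set.mem_ofPred_eq] at hD
    simp only [Finset.sum_const, Finset.card_univ, Fintype.card_fin, nsmul_eq_mul]
    have := mul_le_mul_of_nonneg_left hD (by positivity : (0 : ℝ) ≤ t / 8)
    linarith
  · have hXabs : ∀ ω, |X ω| ≤ 2 := fun ω => by
      simp only [hX]
      split_ifs
      · exact hY ω
      · simp
    have hXsq : ∀ ω, X ω ^ 2 ≤ 4 * if P ω then 1 else 0 := fun ω => by
      simp only [hX]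
      split_ifs
      · have := hY ω
        rw [← sq_abs]
        nlinarith [abs_nonneg (Y ω)]
      · simp
    have hexp : ∀ ω, Real.exp (t / 8 * X ω) ≤
        1 + t / 8 * X ω + (t / 8) ^ 2 * (4 * if P ω then 1 else 0) := fun ω => by
      have habs : |t / 8 * X ω| ≤ 1 := by
        rw [abs_mul, abs_of_nonneg (by positivity)]
        nlinarith [hXabs ω, abs_nonneg (X ω)]
      have h1 := Real.abs_exp_sub_one_sub_id_le habs
      have h2 := le_abs_self (Real.exp (t / 8 * X ω) - 1 - t / 8 * X ω)
      have h3 := mul_le_mul_of_nonneg_left (hXsq ω) (sq_nonneg (t / 8))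
      nlinarith
    have h2 : ∑ ω, w ω * Real.exp (t / 8 * X ω - t / 8 * (v * t)) ≤
        Real.exp (-(v * t ^ 2 / 16)) := by
      calc ∑ ω, w ω * Real.exp (t / 8 * X ω - t / 8 * (v * t))
          = Real.exp (-(t / 8 * (v * t))) * ∑ ω, w ω * Real.exp (t / 8 * X ω) := by
            rw [Finset.mul_sum]
            refine Finset.sum_congr rfl fun ω _ => ?_
            rw [sub_eq_add_neg, Real.exp_add]
            ring
        _ ≤ Real.exp (-(t / 8 * (v * t))) *
            ∑ ω, w ω * (1 + t / 8 * X ω + (t / 8) ^ 2 * (4 * if P ω then 1 else 0)) := by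
            refine mul_le_mul_of_nonneg_left ?_ (Real.exp_pos _).le
            exact Finset.sum_le_sum fun ω _ => mul_le_mul_of_nonneg_left (hexp ω) (hw ω)
        _ = Real.exp (-(t / 8 * (v * t))) * (1 + (t / 8) ^ 2 * 4 * v) := by
            congr 1
            calc _ = ∑ ω, w ω + t / 8 * ∑ ω, w ω * X ω +
                  (t / 8) ^ 2 * 4 * ∑ ω, w ω * (if P ω then 1 else 0) := by
                  rw [Finset.mul_sum, Finset.mul_sum, ← Finset.sum_add_distrib,
                    ← Finset.sum_add_distrib]
                  refine Finset.sum_congr rfl fun ω _ => ?_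
                  ring
              _ = _ := by rw [hw1, hmean, hv]; ring
        _ ≤ Real.exp (-(t / 8 * (v * t))) * Real.exp ((t / 8) ^ 2 * 4 * v) := by
            refine mul_le_mul_of_nonneg_left ?_ (Real.exp_pos _).le
            have := Real.add_one_le_exp ((t / 8) ^ 2 * 4 * v)
            linarith
        _ = Real.exp (-(v * t ^ 2 / 16)) := by
            rw [← Real.exp_add]
            congr 1
            ring
    calc _ ≤ Real.exp (-(v * t ^ 2 / 16)) ^ τ := pow_le_pow_left₀
          (Finset.sum_nonneg fun ω _ => mul_nonneg (hw ω) (Real.exp_pos _).le) h2 τ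
      _ = Real.exp (-(τ * v * t ^ 2 / 16)) := by rw [← Real.exp_nat_mul]; congr 1; ring

lemma iidProb_miss_le (hw : ∀ ω, 0 ≤ w ω) (hw1 : ∑ ω, w ω = 1) (P : Ω → Prop) [DecidablePred P]
    {v : ℝ} (hv : ∑ ω, w ω * (if P ω then 1 else 0) = v) :
    iidProb w {D : Fin τ → Ω | ∀ i, ¬ P (D i)} ≤ (1 - v) ^ τ := by
  refine (iidProb_le_pow hw (f := fun ω => if P ω then 0 else 1) (fun ω => by positivity)
    ?_).trans (le_of_eq ?_)
  · intro D hD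
    simp only [Set.mem_ofPred_eq] at hD
    simp [hD]
  · congr 1
    have h1 : ∀ ω, w ω * (if P ω then 0 else 1) = w ω - w ω * (if P ω then 1 else 0) :=
      fun ω => by split_ifs <;> simp
    simp only [h1]
    rw [Finset.sum_sub_distrib, hw1, hv]

end Independent

/-! ### The smallest positive visitation probability. -/

section Support

variable {S A : Type*} [Fintype S] [Fintype A] {H : ℕ} [NeZero H]
  (μ₀ : stdSimplex ℝ S) (p : Trans S A H) (π : Policy S A H)

lemma rhoMin_le_visit {s : S} {a : A} {h : Fin H} (hz : (s, a, h) ∈ saSupport μ₀ p π) :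
    rhoMin μ₀ p π ≤ visit μ₀ p π h s a :=
  csInf_le ((Set.toFinite _).image _).bddBelow ⟨(s, a, h), hz, rfl⟩

lemma saSupport_nonempty : (saSupport μ₀ p π).Nonempty := by
  have hpos : ∃ ω, 0 < trajProb μ₀ p π ω := by
    by_contra! hcon
    have := Finset.sum_nonpos fun ω (_ : ω ∈ Finset.univ) => hcon ω
    rw [sum_trajProb] at this
    linarith
  obtain ⟨ω, hω⟩ := hpos
  exact ⟨((ω 0).1, (ω 0).2, 0), visit_pos_of_trajProb_pos μ₀ p π hω 0⟩

lemma exists_visit_eq_rhoMin : ∃ s a h, (s, a, h) ∈ saSupport μ₀ p π ∧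
    visit μ₀ p π h s a = rhoMin μ₀ p π := by
  obtain ⟨⟨s, a, h⟩, hz, he⟩ := ((saSupport_nonempty μ₀ p π).image
    (fun x : S × A × Fin H => visit μ₀ p π x.2.2 x.1 x.2.1)).csInf_mem
    ((Set.toFinite _).image _)
  exact ⟨s, a, h, hz, he⟩

lemma rhoMin_pos : 0 < rhoMin μ₀ p π := by
  obtain ⟨s, a, h, hz, he⟩ := exists_visit_eq_rhoMin μ₀ p π
  rw [← he]
  exact hz

lemma visit_le_one (h : Fin H) (s : S) (a : A) : visit μ₀ p π h s a ≤ 1 := by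
  rw [← sum_visit μ₀ p π h]
  refine (visit_le_visitState μ₀ p π h s a).trans ?_
  exact Finset.single_le_sum (f := fun s => ∑ a, visit μ₀ p π h s a)
    (fun s _ => visitState_nonneg μ₀ p π h s) (Finset.mem_univ s)

lemma rhoMin_le_one : rhoMin μ₀ p π ≤ 1 := by
  obtain ⟨s, a, h, -, he⟩ := exists_visit_eq_rhoMin μ₀ p π
  rw [← he]
  exact visit_le_one μ₀ p π h s a

/-- The visitation masses sum to one at each stage, hence to `H` in all, and each point of the
support has mass at least `rhoMin`. -/
lemma ncard_saSupport_mul_le : (saSupport μ₀ p π).ncard * rhoMin μ₀ p π ≤ H := by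
  classical
  rw [Set.ncard_eq_toFinset_card', ← nsmul_eq_mul]
  calc (saSupport μ₀ p π).toFinset.card • rhoMin μ₀ p π
      ≤ ∑ x ∈ (saSupport μ₀ p π).toFinset, visit μ₀ p π x.2.2 x.1 x.2.1 := by
        refine Finset.card_nsmul_le_sum _ _ _ fun x hx => ?_
        exact rhoMin_le_visit μ₀ p π (Set.mem_toFinset.1 hx)
    _ ≤ ∑ x : S × A × Fin H, visit μ₀ p π x.2.2 x.1 x.2.1 :=
        Finset.sum_le_sum_of_subset_of_nonneg (Finset.subset_univ _)
          fun x _ _ => visit_nonneg _ _ _ _ _ _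
    _ = ∑ h : Fin H, ∑ s, ∑ a, visit μ₀ p π h s a := by
        simp only [Fintype.sum_prod_type]
        symm
        rw [Finset.sum_comm]
        refine Finset.sum_congr rfl fun s _ => ?_
        rw [Finset.sum_comm]
    _ = H := by simp [sum_visit]

end Support

/-! ### The empirical model and its `L¹` error. -/

section Estimation

variable {S A : Type*} [Fintype S] [Fintype A] {H τ : ℕ}

open Classical in
/-- Number of visits of `(s, a)` at stage `h`. -/
noncomputable def visits (Db : Fin τ → Traj S A H) (h : Fin H) (s : S) (a : A) : ℝ :=
  ∑ i, if Db i h = (s, a) then 1 else 0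

open Classical in
lemma sum_count_mul (Db : Fin τ → Traj S A H) (h : Fin H) (hn : h.1 + 1 < H) (s : S) (a : A)
    (f : S → ℝ) :
    ∑ s', (count Db h hn s a s' : ℝ) * f s' =
      ∑ i, if Db i h = (s, a) then f (Db i ⟨h.1 + 1, hn⟩).1 else 0 := by
  have h1 : ∀ s', (count Db h hn s a s' : ℝ) * f s' =
      ∑ i, if Db i h = (s, a) ∧ (Db i ⟨h.1 + 1, hn⟩).1 = s' then f s' else 0 := by
    intro s'
    rw [count, Finset.card_filter, Nat.cast_sum, Finset.sum_mul]
    refine Finset.sum_congr rfl fun i _ => ?_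
    split_ifs <;> simp
  simp only [h1]
  rw [Finset.sum_comm]
  refine Finset.sum_congr rfl fun i _ => ?_
  by_cases hi : Db i h = (s, a)
  · simp [hi]
  · simp [hi]

lemma sum_count (Db : Fin τ → Traj S A H) (h : Fin H) (hn : h.1 + 1 < H) (s : S) (a : A) :
    ∑ s', (count Db h hn s a s' : ℝ) = visits Db h s a := by
  simpa [visits] using sum_count_mul Db h hn s a fun _ => 1

lemma mem_estSaSupport_iff (Db : Fin τ → Traj S A H) (h : Fin H) (s : S) (a : A) :
    (s, a, h) ∈ estSaSupport Db ↔ 0 < visits Db h s a := by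
  classical
  constructor
  · rintro ⟨i, hi⟩
    refine Finset.sum_pos' (fun i _ => by positivity) ⟨i, Finset.mem_univ _, ?_⟩
    rw [if_pos hi]
    exact one_pos
  · intro hpos
    by_contra hcon
    refine hpos.ne' (Finset.sum_eq_zero fun i _ => if_neg fun hi => hcon ⟨i, hi⟩)

lemma one_le_visits {Db : Fin τ → Traj S A H} {h : Fin H} {s : S} {a : A}
    (hz : (s, a, h) ∈ estSaSupport Db) : 1 ≤ visits Db h s a := by
  classical
  obtain ⟨i, hi⟩ := hz
  refine le_trans ?_ (Finset.single_le_sum (f := fun i => if Db i h = (s, a) then (1 : ℝ) else 0)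
    (fun i _ => by positivity) (Finset.mem_univ i))
  rw [if_pos hi]

lemma estTrans_of_mem {Db : Fin τ → Traj S A H} {h : Fin H} {s : S} {a : A}
    (hz : (s, a, h) ∈ estSaSupport Db) (hn : h.1 + 1 < H) (s' : S) :
    estTrans Db h hn s a s' = count Db h hn s a s' / visits Db h s a := by
  rw [estTrans, sum_count, max_eq_right (one_le_visits hz)]

/-- The empirical transition probabilities extend to a transition model. -/
lemma exists_estimate (p : Trans S A H) (Db : Fin τ → Traj S A H) :
    ∃ q : Trans S A H, estTransClass Db = preClass q (estSaSupport Db) ∧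
      ∀ s a h, (s, a, h) ∈ estSaSupport Db → ∀ (hn : h.1 + 1 < H) s',
        q h s a s' = count Db h hn s a s' / visits Db h s a := by
  classical
  have key : ∀ h s a, ∃ x : stdSimplex ℝ S, (s, a, h) ∈ estSaSupport Db →
      ∀ (hn : h.1 + 1 < H) s', x s' = count Db h hn s a s' / visits Db h s a := by
    intro h s a
    by_cases hz : (s, a, h) ∈ estSaSupport Db ∧ h.1 + 1 < H
    · obtain ⟨hz, hn⟩ := hz
      have hpos := (mem_estSaSupport_iff Db h s a).1 hz
      refine ⟨⟨fun s' => count Db h hn s a s' / visits Db h s a, fun s' => by positivity, ?_⟩,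
        fun _ _ _ => rfl⟩
      rw [← Finset.sum_div, sum_count, div_self hpos.ne']
    · exact ⟨p h s a, fun hz' hn => absurd ⟨hz', hn⟩ hz⟩
  choose q hq using key
  refine ⟨q, ?_, fun s a h => hq h s a⟩
  ext p'
  constructor
  · intro hp' s a h hz hn
    ext s'
    rw [hp' s a h hz hn s', estTrans_of_mem hz, hq h s a hz hn s']
  · intro hp' s a h hz hn s'
    rw [hp' s a h hz hn, estTrans_of_mem hz, hq h s a hz hn s']

lemma feasibleOn_congr (p : Trans S A H) {π π' : DetPolicy S A H} {X : Set (S × Fin H)}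
    (h : ∀ s h, (s, h) ∈ X → π h s = π' h s) : feasibleOn p π X = feasibleOn p π' X := by
  have h1 : policyClass π.toPolicy X = policyClass π'.toPolicy X := by
    ext σ
    refine forall_congr' fun s => forall_congr' fun k => forall_congr' fun hs => ?_
    rw [DetPolicy.toPolicy, DetPolicy.toPolicy, h s k hs]
  ext r
  unfold feasibleOn
  rw [h1]
  refine forall_congr' fun σ => forall_congr' fun _ => forall_congr' fun s =>
    forall_congr' fun k => forall_congr' fun hs => ?_
  rw [h s k hs]

open Classical in
/-- The function equal to `1` on `B` and to `-1` elsewhere. -/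
noncomputable def signFun (B : Finset S) (s : S) : ℝ := if s ∈ B then 1 else -1

lemma abs_signFun (B : Finset S) (s : S) : |signFun B s| = 1 := by
  unfold signFun
  split_ifs <;> simp

open Classical in
/-- States reachable at stage `h`. -/
noncomputable def reachable [NeZero H] (μ₀ : stdSimplex ℝ S) (p : Trans S A H)
    (π : Policy S A H) (h : Fin H) : Finset S :=
  Finset.univ.filter fun s => (s, h) ∈ stateSupport μ₀ p π

-- The `L¹` norm is attained by the sign function of the set where `q` exceeds `p`. Next states that
-- the behavioral policy cannot reach have weight zero in both models, so subsets of the reachable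
-- states suffice.
open Classical in
lemma sum_abs_sub_le [NeZero H] {μ₀ : stdSimplex ℝ S} {p q : Trans S A H} {πb : Policy S A H}
    {Db : Fin τ → Traj S A H} (hpos : ∀ i, 0 < trajProb μ₀ p πb (Db i)) {s : S} {a : A} {h : Fin H}
    (hz : (s, a, h) ∈ estSaSupport Db) (hn : h.1 + 1 < H)
    (hq : ∀ s', q h s a s' = count Db h hn s a s' / visits Db h s a) {c : ℝ}
    (hdev : ∀ B ∈ (reachable μ₀ p πb ⟨h.1 + 1, hn⟩).powerset,
      (∑ i, if Db i h = (s, a) then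
        signFun B (Db i ⟨h.1 + 1, hn⟩).1 - ∑ s', p h s a s' * signFun B s' else 0) ≤
        c * visits Db h s a) :
    ∑ s', |q h s a s' - p h s a s'| ≤ c := by
  have hvis := (mem_estSaSupport_iff Db h s a).1 hz
  set T := reachable μ₀ p πb ⟨h.1 + 1, hn⟩ with hT
  set B := T.filter fun s' => 0 ≤ q h s a s' - p h s a s' with hB
  have hcount : ∀ s', s' ∉ T → q h s a s' - p h s a s' = 0 := by
    intro s' hs'
    have hs'0 : visitState μ₀ p πb ⟨h.1 + 1, hn⟩ s' ≤ 0 := by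
      refine not_lt.1 fun hlt => hs' ?_
      rw [hT, reachable, Finset.mem_filter]
      exact ⟨Finset.mem_univ _, hlt⟩
    have h1 : p h s a s' = 0 := by
      by_contra hne
      obtain ⟨i, hi⟩ := hz
      refine hs'0.not_gt ((visitState_succ_pos μ₀ p πb hn s').2 ⟨s, a, ?_,
        (stdSimplex.zero_le _ _).lt_of_ne' hne⟩)
      simpa only [hi] using visit_pos_of_trajProb_pos μ₀ p πb (hpos i) h
    have h2 : count Db h hn s a s' = 0 := by
      rw [count, Finset.card_eq_zero, Finset.filter_eq_empty_iff]
      rintro i - ⟨-, hi⟩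
      have := visit_pos_of_trajProb_pos μ₀ p πb (hpos i) ⟨h.1 + 1, hn⟩
      rw [hi] at this
      exact hs'0.not_gt (this.trans_le (visit_le_visitState _ _ _ _ _ _))
    rw [hq, h1, h2]
    simp
  have habs : ∀ s', |q h s a s' - p h s a s'| = (q h s a s' - p h s a s') * signFun B s' := by
    intro s'
    by_cases hs' : s' ∈ T
    · by_cases h0 : 0 ≤ q h s a s' - p h s a s'
      · have : s' ∈ B := by rw [hB, Finset.mem_filter]; exact ⟨hs', h0⟩
        rw [signFun, if_pos this, abs_of_nonneg h0, mul_one]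
      · have : s' ∉ B := by rw [hB, Finset.mem_filter]; exact fun hh => h0 hh.2
        rw [signFun, if_neg this, abs_of_neg (not_le.1 h0)]
        ring
    · rw [hcount s' hs']
      simp
  have hmain := hdev B (Finset.mem_powerset.2 (Finset.filter_subset _ _))
  have hsplit : (∑ i, if Db i h = (s, a) then
      signFun B (Db i ⟨h.1 + 1, hn⟩).1 - ∑ s', p h s a s' * signFun B s' else 0) =
      visits Db h s a * ∑ s', (q h s a s' - p h s a s') * signFun B s' := by
    have e1 : ∀ i, (if Db i h = (s, a) then
        signFun B (Db i ⟨h.1 + 1, hn⟩).1 - ∑ s', p h s a s' * signFun B s' else 0) =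
        (if Db i h = (s, a) then signFun B (Db i ⟨h.1 + 1, hn⟩).1 else 0) -
        (if Db i h = (s, a) then 1 else 0) * ∑ s', p h s a s' * signFun B s' := by
      intro i
      split_ifs <;> simp
    simp only [e1]
    rw [Finset.sum_sub_distrib, ← Finset.sum_mul, ← sum_count_mul]
    change _ - visits Db h s a * _ = _
    simp only [sub_mul, Finset.sum_sub_distrib, mul_sub]
    congr 1
    rw [Finset.mul_sum]
    refine Finset.sum_congr rfl fun s' _ => ?_
    rw [hq]
    field_simp
  rw [hsplit, mul_comm c] at hmain
  simp only [habs]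
  exact le_of_mul_le_mul_left hmain hvis

end Estimation

/-! ### Datasets on which IRLO is accurate. -/

section GoodEvent

variable {S A : Type*} [Fintype S] [Fintype A] {H τE τb : ℕ} [NeZero H]
  {μ₀ : stdSimplex ℝ S} {p : Trans S A H} {πE : DetPolicy S A H} {πb : Policy S A H}

lemma hausdorffInf_le {R R' : Set (Reward S A H)} {c : ℝ}
    (h1 : ∀ r ∈ R, ∃ r' ∈ R', dInf r r' ≤ c) (h2 : ∀ r ∈ R', ∃ r' ∈ R, dInf r r' ≤ c) :
    hausdorffInf R R' ≤ ENNReal.ofReal c := by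
  refine max_le (iSup₂_le fun r hr => ?_) (iSup₂_le fun r hr => ?_)
  · obtain ⟨r', hr', hd⟩ := h1 r hr
    exact iInf₂_le_of_le r' hr' (ENNReal.ofReal_le_ofReal hd)
  · obtain ⟨r', hr', hd⟩ := h2 r hr
    exact iInf₂_le_of_le r' hr' (ENNReal.ofReal_le_ofReal (dInf_comm r r' ▸ hd))

/-- With both supports recovered, all four sets are unions or intersections of `feasibleOn p' πE X`,
and the transfer lemmas apply in both directions. -/
lemma hausdorffInf_irlo_le [Nonempty S] [Nonempty A] (hc : Covers μ₀ p πE πb)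
    {DE : Fin τE → Traj S A H} {Db : Fin τb → Traj S A H}
    (hX : estStateSupport DE = stateSupport μ₀ p πE.toPolicy)
    (hZ : estSaSupport Db = saSupport μ₀ p πb) {q : Trans S A H}
    (hclass : estTransClass Db = preClass q (estSaSupport Db))
    (hclosed : IsClosedUnder q πE (stateSupport μ₀ p πE.toPolicy)) {t : ℝ} (ht : 0 ≤ t)
    (hpq : ∀ s a h, (s, a, h) ∈ saSupport μ₀ p πb → h.1 + 1 < H →
      ∑ s', |q h s a s' - p h s a s'| ≤ t) {πhat : DetPolicy S A H}
    (hhat : ∀ s h, (s, h) ∈ stateSupport μ₀ p πE.toPolicy → πhat h s = πE h s) :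
    hausdorffInf (subFeasible μ₀ p πE πb) (irloSub DE Db πhat) ≤ ENNReal.ofReal (H ^ 2 * t) ∧
    hausdorffInf (superFeasible μ₀ p πE πb) (irloSuper DE Db πhat) ≤
      ENNReal.ofReal (H ^ 2 * t) := by
  set X := stateSupport μ₀ p πE.toPolicy with hXdef
  set Z := saSupport μ₀ p πb with hZdef
  have hreach : IsReach μ₀ p πE X := isReach_stateSupport μ₀ p πE
  have hXZ : ∀ s h, (s, h) ∈ X → (s, πE h s, h) ∈ Z := fun s h hs => hc.mem_saSupport s h hs
  have hfeas : ∀ p' ∈ transClass p Z, feasible μ₀ p' πE = feasibleOn p' πE X := fun p' hp' =>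
    feasible_eq_feasibleOn (hreach.congr hXZ (transClass_subset_preClass p Z hp'))
  have hfeas' : ∀ p', feasibleOn p' πhat (estStateSupport DE) = feasibleOn p' πE X := fun p' => by
    rw [hX]
    exact feasibleOn_congr p' hhat
  have hclass' : estTransClass Db = preClass q Z := by rw [hclass, hZ]
  have hsub : ∀ r, r ∈ subFeasible μ₀ p πE πb ↔ ∀ p' ∈ transClass p Z, r ∈ feasibleOn p' πE X := by
    intro r
    simp only [subFeasible, Set.mem_iInter]
    exact forall_congr' fun p' => forall_congr' fun hp' => by rw [hfeas p' hp']
  have hsuper : ∀ r, r ∈ superFeasible μ₀ p πE πb ↔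
      ∃ p' ∈ transClass p Z, r ∈ feasibleOn p' πE X := by
    intro r
    simp only [superFeasible, Set.mem_iUnion, exists_prop]
    exact exists_congr fun p' => and_congr_right fun hp' => by rw [hfeas p' hp']
  have hsub' : ∀ r, r ∈ irloSub DE Db πhat ↔ ∀ p' ∈ preClass q Z, r ∈ feasibleOn p' πE X := by
    intro r
    simp only [irloSub, Set.mem_iInter, hfeas', hclass']
  have hsuper' : ∀ r, r ∈ irloSuper DE Db πhat ↔
      ∃ p' ∈ preClass q Z, r ∈ feasibleOn p' πE X := by
    intro r
    simp only [irloSuper, Set.mem_iUnion, hfeas', hclass', exists_prop]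
  have hpq' : ∀ s a h, (s, a, h) ∈ Z → h.1 + 1 < H → ∑ s', |p h s a s' - q h s a s'| ≤ t := by
    intro s a h hz hn
    simp only [abs_sub_comm (p h s a _)]
    exact hpq s a h hz hn
  refine ⟨hausdorffInf_le (fun r hr => ?_) (fun r hr => ?_),
    hausdorffInf_le (fun r hr => ?_) (fun r hr => ?_)⟩
  · obtain ⟨r', hr', hd⟩ := exists_near_inter hclosed hXZ ht hpq' ((hsub r).1 hr)
    exact ⟨r', (hsub' r').2 hr', hd⟩
  · obtain ⟨r', hr', hd⟩ := exists_near_inter hreach.closed hXZ ht hpq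
      (fun q' hq' => (hsub' r).1 hr q' (transClass_subset_preClass q Z hq'))
    exact ⟨r', (hsub r').2 fun p' hp' => hr' p' (transClass_subset_preClass p Z hp'), hd⟩
  · obtain ⟨p', hp', hr⟩ := (hsuper r).1 hr
    obtain ⟨r', ⟨q', hq', hr'⟩, hd⟩ := exists_near_union hclosed hXZ ht hpq'
      ⟨p', transClass_subset_preClass p Z hp', hr⟩
    exact ⟨r', (hsuper' r').2 ⟨q', transClass_subset_preClass q Z hq', hr'⟩, hd⟩
  · obtain ⟨r', hr', hd⟩ := exists_near_union hreach.closed hXZ ht hpq ((hsuper' r).1 hr)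
    exact ⟨r', (hsuper r').2 hr', hd⟩

open Classical in
/-- Behavioral datasets that visit `(s, a)` at stage `h` too rarely. -/
def fewVisits (μ₀ : stdSimplex ℝ S) (p : Trans S A H) (πb : Policy S A H) (τ : ℕ)
    (x : S × A × Fin H) : Set (Fin τ → Traj S A H) :=
  {D | (∑ i, if D i x.2.2 = (x.1, x.2.1) then 1 else 0 : ℝ) <
    τ * visit μ₀ p πb x.2.2 x.1 x.2.1 / 2}

open Classical in
/-- Behavioral datasets on which the empirical mean of `signFun B` after `(s, a)` at stage `h`
exceeds its mean too much. -/
def largeDeviation (μ₀ : stdSimplex ℝ S) (p : Trans S A H) (πb : Policy S A H) (τ : ℕ) (t : ℝ)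
    (x : S × A × Fin H) (hn : x.2.2.1 + 1 < H) (B : Finset S) : Set (Fin τ → Traj S A H) :=
  {D | τ * visit μ₀ p πb x.2.2 x.1 x.2.1 * t ≤
    ∑ i, if D i x.2.2 = (x.1, x.2.1) then
      signFun B (D i ⟨x.2.2.1 + 1, hn⟩).1 - ∑ s', p x.2.2 x.1 x.2.1 s' * signFun B s' else 0}

/-- Behavioral datasets that misestimate the model at `(s, a, h)`. -/
def badAt (μ₀ : stdSimplex ℝ S) (p : Trans S A H) (πb : Policy S A H) (τ : ℕ) (t : ℝ)
    (x : S × A × Fin H) : Set (Fin τ → Traj S A H) :=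
  fewVisits μ₀ p πb τ x ∪ {D | ∃ hn : x.2.2.1 + 1 < H,
    ∃ B ∈ (reachable μ₀ p πb ⟨x.2.2.1 + 1, hn⟩).powerset, D ∈ largeDeviation μ₀ p πb τ t x hn B}

lemma good_of_not_bad (hc : Covers μ₀ p πE πb) {DE : Fin τE → Traj S A H}
    {Db : Fin τb → Traj S A H} {t : ℝ} (ht : 0 ≤ t) (hτ : 0 < τb)
    (hEpos : ∀ i, 0 < trajProb μ₀ p πE.toPolicy (DE i)) (hbpos : ∀ i, 0 < trajProb μ₀ p πb (Db i))
    (hE : ∀ s h, (s, h) ∈ stateSupport μ₀ p πE.toPolicy → ∃ i, (DE i h).1 = s)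
    (hb : ∀ x ∈ saSupport μ₀ p πb, Db ∉ badAt μ₀ p πb τb t x)
    {πhat : DetPolicy S A H} (hhat : IsEstPolicy DE πhat) :
    hausdorffInf (subFeasible μ₀ p πE πb) (irloSub DE Db πhat) ≤
      ENNReal.ofReal (H ^ 2 * (2 * t)) ∧
    hausdorffInf (superFeasible μ₀ p πE πb) (irloSuper DE Db πhat) ≤
      ENNReal.ofReal (H ^ 2 * (2 * t)) := by
  classical
  have hEvis := fun i h => (visit_toPolicy_pos_iff μ₀ p πE h _ _).1
    (visit_pos_of_trajProb_pos μ₀ p πE.toPolicy (hEpos i) h)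
  -- The first behavioral trajectory supplies a state and an action.
  have hne : Nonempty S ∧ Nonempty A := by
    let x := Db ⟨0, hτ⟩ 0
    exact ⟨⟨x.1⟩, ⟨x.2⟩⟩
  obtain ⟨_, _⟩ := hne
  have hX : estStateSupport DE = stateSupport μ₀ p πE.toPolicy := by
    ext ⟨s, h⟩
    constructor
    · rintro ⟨i, hi⟩
      simp only at hi
      exact hi ▸ (hEvis i h).1
    · exact fun hs => hE s h hs
  have hfew : ∀ s a h, (s, a, h) ∈ saSupport μ₀ p πb →
      τb * visit μ₀ p πb h s a / 2 ≤ visits Db h s a := fun s a h hz =>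
    not_lt.1 fun hlt => hb _ hz (Or.inl hlt)
  have hZ : estSaSupport Db = saSupport μ₀ p πb := by
    ext ⟨s, a, h⟩
    constructor
    · rintro ⟨i, hi⟩
      have := visit_pos_of_trajProb_pos μ₀ p πb (hbpos i) h
      simp only at hi
      rwa [hi] at this
    · intro hz
      rw [mem_estSaSupport_iff]
      have hz' : 0 < visit μ₀ p πb h s a := hz
      have hτ' : (0 : ℝ) < τb := by exact_mod_cast hτ
      exact lt_of_lt_of_le (by positivity) (hfew s a h hz)
  obtain ⟨q, hclass, hq⟩ := exists_estimate p Db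
  refine hausdorffInf_irlo_le hc hX hZ hclass ?_ (by positivity) ?_ ?_
  -- A transition of positive empirical frequency was observed, hence is possible under `p`, so `X`
  -- is closed under the estimate as well.
  · intro s h hs hn s' hp
    have hz := hc.mem_saSupport s h hs
    rw [← hZ] at hz
    rw [hq s _ h hz hn s'] at hp
    have hcount : count Db h hn s (πE h s) s' ≠ 0 := by
      intro h0
      rw [h0] at hp
      simp at hp
    obtain ⟨i, hi⟩ := Finset.card_ne_zero.1 hcount
    obtain ⟨hi1, hi2⟩ := (Finset.mem_filter.1 hi).2
    have := trans_pos_of_trajProb_pos μ₀ p πb (hbpos i) h hn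
    rw [hi1, hi2] at this
    exact (isReach_stateSupport μ₀ p πE).closed s h hs hn s' this
  · intro s a h hz hn
    have hz' := hz
    rw [← hZ] at hz'
    refine sum_abs_sub_le hbpos hz' hn (hq s a h hz' hn) fun B hB => ?_
    have h1 : ¬ _ := fun hle => hb _ hz (Or.inr ⟨hn, B, hB, hle⟩)
    refine (not_le.1 h1).le.trans ?_
    -- At least half the expected number of visits occurred, so a deviation `τ v t` is at most `2 t`
    -- per visit; this is the factor `2` in the conclusion.
    have := mul_le_mul_of_nonneg_right (hfew s a h hz) ht
    simp only
    linarith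
  · intro s h hs
    rw [← hX] at hs
    obtain ⟨i, hi⟩ := hhat s h hs
    have := (hEvis i h).2
    rw [hi] at this
    exact this

end GoodEvent

/-! ### Union bounds over the bad events. -/

section Probability

variable {S A : Type*} [Fintype S] [Fintype A] {H : ℕ} [NeZero H]
  (μ₀ : stdSimplex ℝ S) (p : Trans S A H) (πE : DetPolicy S A H) (πb : Policy S A H)

open Classical in
/-- Expert datasets that miss a reachable state. -/
def missing (τ : ℕ) : Set (Fin τ → Traj S A H) :=
  {D | ∃ x ∈ (stateSupport μ₀ p πE.toPolicy).toFinset, D ∈ {D | ∀ i, ¬ (D i x.2).1 = x.1}}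

open Classical in
/-- Behavioral datasets that misestimate the model somewhere. -/
def misestimating (τ : ℕ) (t : ℝ) : Set (Fin τ → Traj S A H) :=
  {D | ∃ x ∈ (saSupport μ₀ p πb).toFinset, D ∈ badAt μ₀ p πb τ t x}

lemma iidProb_missing_le (τ : ℕ) :
    iidProb (trajProb μ₀ p πE.toPolicy) (missing μ₀ p πE τ) ≤
      (stateSupport μ₀ p πE.toPolicy).ncard * (1 - rhoMin μ₀ p πE.toPolicy) ^ τ := by
  classical
  refine (iidProb_biUnion_le (trajProb_nonneg μ₀ p _) _ _).trans ?_
  rw [Set.ncard_eq_toFinset_card', ← nsmul_eq_mul]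
  refine Finset.sum_le_card_nsmul _ _ _ fun x hx => ?_
  obtain ⟨s, h⟩ := x
  have hs : (s, h) ∈ stateSupport μ₀ p πE.toPolicy := Set.mem_toFinset.1 hx
  have hv := sum_visit_mul μ₀ p πE.toPolicy h fun x => if x.1 = s then 1 else 0
  have hv' : ∑ ω, trajProb μ₀ p πE.toPolicy ω * (if (ω h).1 = s then 1 else 0) =
      visitState μ₀ p πE.toPolicy h s := by
    rw [← hv]
    simp [visitState]
  refine (iidProb_miss_le (trajProb_nonneg μ₀ p _) (sum_trajProb μ₀ p _)
    (fun ω : Traj S A H => (ω h).1 = s) hv').trans ?_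
  have hz : (s, πE h s, h) ∈ saSupport μ₀ p πE.toPolicy :=
    (visit_toPolicy_pos_iff μ₀ p πE h s _).2 ⟨hs, rfl⟩
  have h1 := (rhoMin_le_visit μ₀ p πE.toPolicy hz).trans
    (visit_le_visitState μ₀ p πE.toPolicy h s _)
  have h2 : visitState μ₀ p πE.toPolicy h s ≤ 1 := by
    rw [← sum_visit μ₀ p πE.toPolicy h]
    exact Finset.single_le_sum (f := fun s => ∑ a, visit μ₀ p πE.toPolicy h s a)
      (fun s _ => visitState_nonneg μ₀ p _ h s) (Finset.mem_univ s)
  exact pow_le_pow_left₀ (by linarith) (by linarith) τ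

lemma card_reachable_le (h : Fin H) : (reachable μ₀ p πb h).card ≤ maxStateSupport μ₀ p πb := by
  classical
  refine le_trans (le_of_eq ?_) (Finset.le_sup
    (f := fun h : Fin H => {s : S | (s, h) ∈ stateSupport μ₀ p πb}.ncard) (Finset.mem_univ h))
  simp only [Set.ncard_eq_toFinset_card', reachable]
  congr 1
  ext s
  simp

lemma iidProb_largeDeviation_le (τ : ℕ) {t : ℝ} (ht0 : 0 ≤ t) (ht1 : t ≤ 1) (x : S × A × Fin H)
    (hn : x.2.2.1 + 1 < H) (B : Finset S) :
    iidProb (trajProb μ₀ p πb) (largeDeviation μ₀ p πb τ t x hn B) ≤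
      Real.exp (-(τ * visit μ₀ p πb x.2.2 x.1 x.2.1 * t ^ 2 / 16)) := by
  classical
  refine iidProb_deviation_le (trajProb_nonneg μ₀ p πb) (sum_trajProb μ₀ p πb)
    (fun ω => ω x.2.2 = (x.1, x.2.1)) (visit_eq μ₀ p πb _ _ _).symm
    (Y := fun ω => signFun B (ω ⟨x.2.2.1 + 1, hn⟩).1 -
      ∑ s', p x.2.2 x.1 x.2.1 s' * signFun B s') (fun ω => ?_) ?_ ht0 ht1
  · have h1 := abs_sum_mul_le (p x.2.2 x.1 x.2.1) (f := signFun B) (c := 1)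
      fun s => (abs_signFun B s).le
    have h2 := abs_signFun B (ω ⟨x.2.2.1 + 1, hn⟩).1
    refine (abs_sub _ _).trans ?_
    linarith
  · rw [sum_trajProb_transition μ₀ p πb hn x.1 x.2.1
      (fun s => signFun B s - ∑ s', p x.2.2 x.1 x.2.1 s' * signFun B s')]
    simp [mul_sub, ← Finset.sum_mul]

lemma iidProb_badAt_le (τ : ℕ) {t : ℝ} (ht0 : 0 ≤ t) (ht1 : t ≤ 1) (x : S × A × Fin H) :
    iidProb (trajProb μ₀ p πb) (badAt μ₀ p πb τ t x) ≤
      Real.exp (-(τ * visit μ₀ p πb x.2.2 x.1 x.2.1 / 8)) +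
        2 ^ maxStateSupport μ₀ p πb *
          Real.exp (-(τ * visit μ₀ p πb x.2.2 x.1 x.2.1 * t ^ 2 / 16)) := by
  classical
  refine (iidProb_union_le (trajProb_nonneg μ₀ p πb) _ _).trans (add_le_add ?_ ?_)
  · exact iidProb_few_le (trajProb_nonneg μ₀ p πb) (sum_trajProb μ₀ p πb)
      (fun ω => ω x.2.2 = (x.1, x.2.1)) (visit_eq μ₀ p πb _ _ _).symm
  · by_cases hn : x.2.2.1 + 1 < H
    · simp only [hn, exists_true_left]
      refine (iidProb_biUnion_le (trajProb_nonneg μ₀ p πb) _ _).trans ?_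
      refine (Finset.sum_le_card_nsmul _ _ _ fun B _ =>
        iidProb_largeDeviation_le μ₀ p πb τ ht0 ht1 x hn B).trans ?_
      rw [nsmul_eq_mul, Finset.card_powerset]
      refine mul_le_mul_of_nonneg_right ?_ (Real.exp_pos _).le
      push_cast
      exact pow_le_pow_right₀ (by norm_num) (card_reachable_le μ₀ p πb _)
    -- At the last stage no transition has to be estimated and the deviation event is empty.
    · refine le_trans (le_of_eq ?_) (by positivity : (0 : ℝ) ≤ _)
      simp [iidProb, hn]

lemma iidProb_misestimating_le (τ : ℕ) {t : ℝ} (ht0 : 0 ≤ t) (ht1 : t ≤ 1) :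
    iidProb (trajProb μ₀ p πb) (misestimating μ₀ p πb τ t) ≤
      (saSupport μ₀ p πb).ncard * (Real.exp (-(τ * rhoMin μ₀ p πb / 8)) +
        2 ^ maxStateSupport μ₀ p πb * Real.exp (-(τ * rhoMin μ₀ p πb * t ^ 2 / 16))) := by
  classical
  refine (iidProb_biUnion_le (trajProb_nonneg μ₀ p πb) _ _).trans ?_
  rw [Set.ncard_eq_toFinset_card', ← nsmul_eq_mul]
  refine Finset.sum_le_card_nsmul _ _ _ fun x hx => ?_
  refine (iidProb_badAt_le μ₀ p πb τ ht0 ht1 x).trans ?_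
  have hx' : (x.1, x.2.1, x.2.2) ∈ saSupport μ₀ p πb := Set.mem_toFinset.1 hx
  have h1 := rhoMin_le_visit μ₀ p πb hx'
  gcongr

/-- Datasets containing a trajectory of probability zero carry no weight, so `E` need only be
verified on possible trajectories. -/
lemma one_sub_le_dataProb {τE τb : ℕ} {E : Set ((Fin τE → Traj S A H) × (Fin τb → Traj S A H))}
    {B₁ : Set (Fin τE → Traj S A H)} {B₂ : Set (Fin τb → Traj S A H)}
    (hE : ∀ DE Db, (∀ i, 0 < trajProb μ₀ p πE.toPolicy (DE i)) →
      (∀ i, 0 < trajProb μ₀ p πb (Db i)) → DE ∉ B₁ → Db ∉ B₂ → (DE, Db) ∈ E) :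
    1 - (iidProb (trajProb μ₀ p πE.toPolicy) B₁ + iidProb (trajProb μ₀ p πb) B₂) ≤
      dataProb (τE := τE) (τb := τb) μ₀ p πE πb E := by
  classical
  set w₁ : (Fin τE → Traj S A H) → ℝ := fun D => ∏ i, trajProb μ₀ p πE.toPolicy (D i) with hw₁
  set w₂ : (Fin τb → Traj S A H) → ℝ := fun D => ∏ i, trajProb μ₀ p πb (D i) with hw₂
  have hnn₁ : ∀ D, 0 ≤ w₁ D := fun D => Finset.prod_nonneg fun i _ => trajProb_nonneg _ _ _ _
  have hnn₂ : ∀ D, 0 ≤ w₂ D := fun D => Finset.prod_nonneg fun i _ => trajProb_nonneg _ _ _ _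
  have hs₁ : ∑ D, w₁ D = 1 := iidProb_univ (sum_trajProb μ₀ p πE.toPolicy)
  have hs₂ : ∑ D, w₂ D = 1 := iidProb_univ (sum_trajProb μ₀ p πb)
  have e0 : ∑ D : (Fin τE → Traj S A H) × (Fin τb → Traj S A H), w₁ D.1 * w₂ D.2 = 1 := by
    rw [Fintype.sum_prod_type]
    simp only [← Finset.mul_sum, hs₂, mul_one, hs₁]
  have e1 : ∑ D : (Fin τE → Traj S A H) × (Fin τb → Traj S A H),
      (if D.1 ∈ B₁ then w₁ D.1 else 0) * w₂ D.2 = iidProb (trajProb μ₀ p πE.toPolicy) B₁ := by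
    rw [Fintype.sum_prod_type]
    simp only [← Finset.mul_sum, hs₂, mul_one]
    rfl
  have e2 : ∑ D : (Fin τE → Traj S A H) × (Fin τb → Traj S A H),
      w₁ D.1 * (if D.2 ∈ B₂ then w₂ D.2 else 0) = iidProb (trajProb μ₀ p πb) B₂ := by
    rw [Fintype.sum_prod_type]
    simp only [← Finset.mul_sum, ← Finset.sum_mul, hs₁, one_mul]
    rfl
  rw [sub_le_iff_le_add, ← e1, ← e2, ← e0, dataProb, ← Finset.sum_add_distrib,
    ← Finset.sum_add_distrib]
  refine Finset.sum_le_sum fun D _ => ?_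
  have h1 := hnn₁ D.1
  have h2 := hnn₂ D.2
  have h12 := mul_nonneg h1 h2
  by_cases hb₁ : D.1 ∈ B₁
  · rw [if_pos hb₁]
    have : 0 ≤ w₁ D.1 * (if D.2 ∈ B₂ then w₂ D.2 else 0) :=
      mul_nonneg h1 (by split_ifs <;> simp [h2])
    have : 0 ≤ if D ∈ E then w₁ D.1 * w₂ D.2 else 0 := by split_ifs <;> simp [h12]
    linarith
  by_cases hb₂ : D.2 ∈ B₂
  · rw [if_neg hb₁, if_pos hb₂]
    have : 0 ≤ if D ∈ E then w₁ D.1 * w₂ D.2 else 0 := by split_ifs <;> simp [h12]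
    linarith
  rw [if_neg hb₁, if_neg hb₂, zero_mul, mul_zero, add_zero, add_zero]
  by_cases h0 : w₁ D.1 * w₂ D.2 = 0
  · rw [h0]
    split_ifs
    · exact le_rfl
    · exact le_rfl
  · have g1 := Finset.prod_ne_zero_iff.1 (left_ne_zero_of_mul h0)
    have g2 := Finset.prod_ne_zero_iff.1 (right_ne_zero_of_mul h0)
    rw [if_pos (hE D.1 D.2
      (fun i => (trajProb_nonneg _ _ _ _).lt_of_ne' (g1 i (Finset.mem_univ _)))
      (fun i => (trajProb_nonneg _ _ _ _).lt_of_ne' (g2 i (Finset.mem_univ _))) hb₁ hb₂)]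

end Probability

/-! ### From sample sizes to failure probabilities. -/

section Rates

lemma one_le_logInv (δ : ℝ) : 1 ≤ logInv δ := le_max_left _ _

lemma exp_neg_logInv_le {δ : ℝ} (hδ : 0 < δ) : Real.exp (-logInv δ) ≤ δ := by
  have h1 : -logInv δ ≤ Real.log δ := by
    have : Real.log (1 / δ) ≤ logInv δ := le_max_right _ _
    rw [one_div, Real.log_inv] at this
    linarith
  calc Real.exp (-logInv δ) ≤ Real.exp (Real.log δ) := Real.exp_le_exp.2 h1
    _ = δ := Real.exp_log hδ

lemma exp_neg_two_le : Real.exp (-2) ≤ 1 / 3 := by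
  rw [Real.exp_neg, one_div]
  refine inv_anti₀ (by norm_num) ?_
  have := Real.add_one_le_exp (2 : ℝ)
  linarith

/-- If `a ≤ exp b` and `R` exceeds `b + ℓ_δ + 2`, then `a exp (-R) ≤ δ / 3`. -/
lemma mul_exp_neg_le {a b R δ : ℝ} (hδ : 0 < δ) (ha : a ≤ Real.exp b)
    (hR : b + logInv δ + 2 ≤ R) : a * Real.exp (-R) ≤ δ / 3 := by
  calc a * Real.exp (-R) ≤ Real.exp b * Real.exp (-(b + logInv δ + 2)) :=
        mul_le_mul ha (Real.exp_le_exp.2 (by linarith)) (Real.exp_pos _).le (Real.exp_pos _).le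
    _ = Real.exp (-logInv δ) * Real.exp (-2) := by
        rw [← Real.exp_add, ← Real.exp_add]
        congr 1
        ring
    _ ≤ δ * (1 / 3) := mul_le_mul (exp_neg_logInv_le hδ) exp_neg_two_le (Real.exp_pos _).le hδ.le
    _ = δ / 3 := by ring

lemma half_le_log {x : ℝ} (hx : 0 ≤ x) : 1 / 2 ≤ Real.log (2 + x) := by
  have h1 : Real.log 2 ≤ Real.log (2 + x) := Real.log_le_log (by norm_num) (by linarith)
  have := Real.log_two_gt_d9
  linarith

lemma log_one_div_one_sub_nonneg {ρ : ℝ} (h0 : 0 < ρ) (h1 : ρ ≤ 1) :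
    0 ≤ Real.log (1 / (1 - ρ)) := by
  rcases h1.eq_or_lt with rfl | h1
  · simp
  · apply Real.log_nonneg
    rw [le_div_iff₀ (by linarith)]
    linarith

lemma card_mul_pow_le {ρ δ : ℝ} (h0 : 0 < ρ) (h1 : ρ ≤ 1) (hδ : 0 < δ) {N τ : ℕ} (hτ : 1 ≤ τ)
    (h : 640 * rateE ρ δ * Real.log (2 + N) ^ 1 ≤ τ) : N * (1 - ρ) ^ τ ≤ δ / 3 := by
  -- For `ρ = 1` the rate is `0` by the division convention, and `1 ≤ τ` alone makes the power
  -- vanish.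
  rcases h1.eq_or_lt with rfl | h1
  · rw [sub_self, zero_pow (by omega), mul_zero]
    positivity
  set L := Real.log (1 / (1 - ρ)) with hL
  have hLpos : 0 < L := Real.log_pos (by rw [lt_div_iff₀ (by linarith)]; linarith)
  have hpow : (1 - ρ) ^ τ = Real.exp (-(τ * L)) := by
    rw [hL, one_div, Real.log_inv, mul_neg, neg_neg, Real.exp_nat_mul, Real.exp_log (by linarith)]
  rw [hpow]
  have hℓ := one_le_logInv δ
  have hΛ := half_le_log (Nat.cast_nonneg (α := ℝ) N)
  refine mul_exp_neg_le hδ (b := Real.log (2 + N)) ?_ ?_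
  · rw [Real.exp_log (by positivity)]
    linarith
  · have h2 : 640 * logInv δ * Real.log (2 + N) ≤ τ * L := by
      rw [pow_one, rateE, ← hL] at h
      calc 640 * logInv δ * Real.log (2 + N)
          = 640 * (logInv δ / L) * Real.log (2 + N) * L := by field_simp
        _ ≤ τ * L := mul_le_mul_of_nonneg_right h hLpos.le
    nlinarith

/-- Only the first summand of the rate is used. As `ε ≤ 2 H`, its product with `ρ` is at least a
quarter of `H ^ 2` times `G`, which gives the first two bounds. The constant is `640 = 10 * 64`,
with `64` from `(ε / (2 H ^ 2)) ^ 2 / 16 = ε ^ 2 / (64 H ^ 4)`. -/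
lemma rateB_bounds {H n : ℕ} (hH : 1 ≤ H) {ρ ε δ : ℝ} (h0 : 0 < ρ) (h1 : ρ ≤ 1) (hε : 0 < ε)
    (hεH : ε ≤ 2 * H) {τ : ℕ}
    (h : 640 * rateB H n ρ ε δ * Real.log (2 + rateB H n ρ ε δ) ^ 1 ≤ τ) :
    H / ρ ≤ 4 * rateB H n ρ ε δ ∧
    10 * (logInv δ * (logInv δ + n)) * Real.log (2 + rateB H n ρ ε δ) ≤ τ * ρ / 8 ∧
    10 * (logInv δ * (logInv δ + n)) * Real.log (2 + rateB H n ρ ε δ) ≤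
      τ * ρ * (ε / (2 * H ^ 2)) ^ 2 / 16 := by
  have hℓ := one_le_logInv δ
  have hH' : (1 : ℝ) ≤ H := by exact_mod_cast hH
  have hHpos : (0 : ℝ) < H := by linarith
  have hn : (0 : ℝ) ≤ n := Nat.cast_nonneg n
  set F := rateB H n ρ ε δ with hF
  set M := (H : ℝ) ^ 4 * logInv δ / (ρ * ε ^ 2) * (logInv δ + n) with hM
  set G := logInv δ * (logInv δ + n) with hG
  have hG1 : 1 ≤ G := by nlinarith
  have hMF : M ≤ F := by
    rw [hF, rateB]
    have := div_nonneg (zero_le_one.trans hℓ) (log_one_div_one_sub_nonneg h0 h1)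
    linarith
  have hMG : M * (ρ * ε ^ 2) = H ^ 4 * G := by
    rw [hM, hG]
    field_simp
  have hε2 : ε ^ 2 ≤ 4 * H ^ 2 := by nlinarith
  have hMpos : 0 < M := by
    rw [hM]
    positivity
  have hMG' : H ^ 2 * G ≤ 4 * (M * ρ) := by
    have h2 : (H : ℝ) ^ 2 * (H ^ 2 * G) ≤ H ^ 2 * (4 * (M * ρ)) := by
      calc (H : ℝ) ^ 2 * (H ^ 2 * G) = (M * ρ) * ε ^ 2 := by linarith
        _ ≤ (M * ρ) * (4 * H ^ 2) := mul_le_mul_of_nonneg_left hε2 (by positivity)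
        _ = H ^ 2 * (4 * (M * ρ)) := by ring
    exact le_of_mul_le_mul_left h2 (by positivity)
  have hΛ := half_le_log (hMpos.le.trans hMF)
  set Λ := Real.log (2 + F) with hΛdef
  have hτ : 640 * M * Λ ≤ τ := by
    refine le_trans ?_ h
    rw [pow_one]
    gcongr
  have hGH : G ≤ H ^ 2 * G := le_mul_of_one_le_left (by linarith) (one_le_pow₀ hH')
  have hτρ : 640 * M * Λ * ρ ≤ τ * ρ := mul_le_mul_of_nonneg_right hτ h0.le
  refine ⟨?_, ?_, ?_⟩
  · rw [div_le_iff₀ h0]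
    have h2 : (H : ℝ) ≤ H ^ 2 * G := by nlinarith
    have h3 : M * ρ ≤ F * ρ := mul_le_mul_of_nonneg_right hMF h0.le
    linarith
  · have h2 : G * Λ ≤ 4 * (M * ρ) * Λ :=
      mul_le_mul_of_nonneg_right (hGH.trans hMG') (by linarith)
    have h3 : 0 ≤ G * Λ := mul_nonneg (by linarith) (by linarith)
    linarith
  · have h2 : τ * ρ * (ε / (2 * H ^ 2)) ^ 2 / 16 = τ * (ρ * ε ^ 2) / (64 * H ^ 4) := by
      field_simp
      ring
    rw [h2, le_div_iff₀ (by positivity)]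
    calc 10 * G * Λ * (64 * H ^ 4) = 640 * (H ^ 4 * G) * Λ := by ring
      _ = 640 * M * Λ * (ρ * ε ^ 2) := by rw [← hMG]; ring
      _ ≤ τ * (ρ * ε ^ 2) := mul_le_mul_of_nonneg_right hτ (by positivity)

/-- The union over the support is paid by the logarithm: `N ≤ H / ρ ≤ 4 F ≤ (2 + F) ^ 2 = exp (2
Λ)`. The sign functions cost `2 ^ n ≤ exp n`. -/
lemma failure_le {H n : ℕ} (hH : 1 ≤ H) {ρ ε δ : ℝ} (h0 : 0 < ρ) (h1 : ρ ≤ 1) (hε : 0 < ε)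
    (hεH : ε ≤ 2 * H) (hδ : 0 < δ) {τ N : ℕ} (hN : N * ρ ≤ H)
    (h : 640 * rateB H n ρ ε δ * Real.log (2 + rateB H n ρ ε δ) ^ 1 ≤ τ) :
    N * (Real.exp (-(τ * ρ / 8)) + 2 ^ n * Real.exp (-(τ * ρ * (ε / (2 * H ^ 2)) ^ 2 / 16))) ≤
      δ / 3 + δ / 3 := by
  obtain ⟨hHρ, hR1, hR2⟩ := rateB_bounds hH h0 h1 hε hεH h
  set F := rateB H n ρ ε δ
  have hF0 : 0 ≤ F := by
    have : (0 : ℝ) ≤ H / ρ := by positivity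
    linarith
  have hℓ := one_le_logInv δ
  have hn : (0 : ℝ) ≤ n := Nat.cast_nonneg n
  have hΛ := half_le_log hF0
  set Λ := Real.log (2 + F) with hΛdef
  have hNF : (N : ℝ) ≤ Real.exp (2 * Λ) := by
    have h2 : Real.exp (2 * Λ) = (2 + F) ^ 2 := by
      rw [two_mul, Real.exp_add, hΛdef, Real.exp_log (by linarith), sq]
    rw [h2]
    have h3 : (N : ℝ) ≤ H / ρ := by rwa [le_div_iff₀ h0]
    nlinarith
  have hbound : 2 * Λ + n + logInv δ + 2 ≤ 10 * (logInv δ * (logInv δ + n)) * Λ := by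
    have h2 : logInv δ + n ≤ logInv δ * (logInv δ + n) :=
      le_mul_of_one_le_left (by linarith) hℓ
    have h3 : 10 * (logInv δ + n) * Λ ≤ 10 * (logInv δ * (logInv δ + n)) * Λ := by gcongr
    nlinarith
  rw [mul_add]
  refine add_le_add (mul_exp_neg_le hδ hNF (by linarith)) ?_
  rw [← mul_assoc]
  refine mul_exp_neg_le hδ (b := 2 * Λ + n) ?_ (by linarith)
  rw [Real.exp_add]
  refine mul_le_mul hNF ?_ (by positivity) (Real.exp_pos _).le
  rw [← Real.exp_one_pow]
  gcongr
  have := Real.add_one_le_exp (1 : ℝ)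
  linarith

end Rates

end OfflineIRL

open OfflineIRL
theorem theorem5p2 :
    ∃ C : ℝ, 0 < C ∧ ∃ k : ℕ,
      ∀ (S A : Type*) [Fintype S] [Fintype A] (H : ℕ) [NeZero H]
        (μ₀ : stdSimplex ℝ S) (p : Trans S A H) (πE : DetPolicy S A H) (πb : Policy S A H),
        Covers μ₀ p πE πb →
        ∀ (ε δ : ℝ), 0 < ε → ε ≤ 2 * H → 0 < δ → δ < 1 →
        ∀ (τE τb : ℕ), 1 ≤ τE →
          C * rateE (rhoMin μ₀ p πE.toPolicy) δ *
              Real.log (2 + (stateSupport μ₀ p πE.toPolicy).ncard) ^ k ≤ τE →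
          C * rateB H (maxStateSupport μ₀ p πb) (rhoMin μ₀ p πb) ε δ *
              Real.log (2 + rateB H (maxStateSupport μ₀ p πb) (rhoMin μ₀ p πb) ε δ) ^ k ≤ τb →
          IRLOIsPAC μ₀ p πE πb τE τb ε δ := by
  -- One logarithmic factor is enough.
  refine ⟨640, by norm_num, 1, ?_⟩
  intro S A _ _ H _ μ₀ p πE πb hc ε δ hε hεH hδ hδ1 τE τb hτE hE hB
  classical
  have hH : 1 ≤ H := NeZero.pos H
  have hH' : (1 : ℝ) ≤ H := by exact_mod_cast hH
  -- The accuracy `t = ε / (2 H ^ 2)` turns the final bound `H ^ 2 * (2 * t)` into `ε`; the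
  -- deviation inequality needs `t ≤ 1`.
  have ht1 : ε / (2 * (H : ℝ) ^ 2) ≤ 1 := by
    rw [div_le_one (by positivity)]
    nlinarith
  have hρ0 := rhoMin_pos μ₀ p πb
  have hρ1 := rhoMin_le_one μ₀ p πb
  have hτb : 0 < τb := by
    obtain ⟨h1, h2, -⟩ := rateB_bounds hH hρ0 hρ1 hε hεH hB
    have hF0 : 0 ≤ rateB H (maxStateSupport μ₀ p πb) (rhoMin μ₀ p πb) ε δ := by
      have : (0 : ℝ) ≤ H / rhoMin μ₀ p πb := by positivity
      linarith
    have hΛ := half_le_log hF0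
    have hℓ := one_le_logInv δ
    by_contra hcon
    obtain rfl : τb = 0 := by omega
    have : 0 < 10 * (logInv δ * (logInv δ + (maxStateSupport μ₀ p πb : ℝ))) *
        Real.log (2 + rateB H (maxStateSupport μ₀ p πb) (rhoMin μ₀ p πb) ε δ) := by positivity
    rw [Nat.cast_zero, zero_mul, zero_div] at h2
    linarith
  have hm := (iidProb_missing_le μ₀ p πE τE).trans
    (card_mul_pow_le (rhoMin_pos μ₀ p _) (rhoMin_le_one μ₀ p _) hδ hτE hE)
  have hb := (iidProb_misestimating_le μ₀ p πb τb (t := ε / (2 * (H : ℝ) ^ 2)) (by positivity)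
    ht1).trans (failure_le hH hρ0 hρ1 hε hεH hδ (ncard_saSupport_mul_le μ₀ p πb) hB)
  refine le_trans ?_ (one_sub_le_dataProb μ₀ p πE πb (B₁ := missing μ₀ p πE τE)
    (B₂ := misestimating μ₀ p πb τb (ε / (2 * (H : ℝ) ^ 2))) ?_)
  -- Missed states, rare visits and deviations cost `δ / 3` each.
  · linarith
  · intro DE Db hEpos hbpos hDE hDb πhat hhat
    have he : (H : ℝ) ^ 2 * (2 * (ε / (2 * (H : ℝ) ^ 2))) = ε := by field_simp
    have := good_of_not_bad hc (t := ε / (2 * (H : ℝ) ^ 2)) (by positivity) hτb hEpos hbpos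
      (fun s h hs => ?_) (fun x hx hbad => hDb ⟨x, Set.mem_toFinset.2 hx, hbad⟩) hhat
    · rwa [he] at this
    · by_contra! hcon
      exact hDE ⟨(s, h), Set.mem_toFinset.2 hs, hcon⟩
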